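/- Let $X'$ be a compact connected Riemann surface (of arbitrary genus), $S\subset X'$ a finite set of punctures, $X=X'\setminus S$, and let $w_k$ ($k$ in a finite index set) be holomorphic $1$-forms on $X$ (for example, forms representing a basis of $H^1(X,\mathbb C)$). A puncture $P\in S$ is *good* if exactly one of the forms has a pole at $P$, this pole is simple, and all the other forms extend holomorphically to $P$. Let $P_j,P_i\in S$ be good punctures, let $w_j,w_i$ be the forms with a pole there, and let $\rho_j,\rho_i$ be their residues (one may scale so that $\rho_i=1$). Let $\gamma:[0,1]\to X'$ be a path from $P_j$ to $P_i$, continuous, $C^1$ and with values in $X$ on $(0,1)$. Fix local coordinates centred at $P_j$ and at $P_i$, and continuous branches of the logarithm of these coordinates along the initial and the final piece of $\gamma$; assume that the imaginary parts of these branches are bounded ($\gamma$ does not spiral infinitely around its end points; this is automatic if $\gamma$ has non-zero tangent vectors there). Write $\log\varepsilon$ for the branch along the path and $u$ for the coordinate at $P_i$, with $u(P_i)=0$. *Iterated integrals.* For a word $v=w_{a_1}\cdots w_{a_r}$ and a path $\alpha$ with $\alpha^*w_a=g_a\,dt$ let $\int_\alpha v^{\rm op}=\int_{t_1\le\cdots\le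 t_r}g_{a_r}(t_1)\,dt_1\cdots g_{a_1}(t_r)\,dt_r$. Let $P_k$ ($k\in\{i,j\}$) be the starting point of $\alpha$, let $z\in X$ be its end point, and let $\alpha_\varepsilon$ be the part of $\alpha$ after the parameter value $\varepsilon$. Put $\mathrm{Li}_{w_k,k}(z)=\lim_{\varepsilon\to0}\big(\rho_k\log\varepsilon+\int_{\alpha_\varepsilon}w_k\big)$, where $\log\varepsilon$ is the chosen logarithm of the coordinate of $\alpha(\varepsilon)$, and $\mathrm{Li}_{v,k}(z)=\lim_{\varepsilon\to0}\int_{\alpha_\varepsilon}v^{\rm op}$ for words $v$ not ending in $w_k$ (extended linearly). For an arbitrary word $v$, with its unique decomposition $v=\sum_s v(s)\sqcup\!\sqcup\, w_k^s$ ($\sqcup\!\sqcup$ is the shuffle product) in which the $v(s)$ are linear combinations of words not ending in $w_k$, put $\mathrm{Li}_{v,k}(z)=\sum_s\frac{1}{s!}\mathrm{Li}_{w_k,k}(z)^s\,\mathrm{Li}_{v(s),k}(z)$. Let $L_k(z)=\sum_v\mathrm{Li}_{v,k}(z)\,\mathbf x_v$ be the generating series in free non-commuting variables. For $t_0\in(0,1)$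 and a $C^1$ path $c$ in $X$ from $\gamma(t_0)$ to $z$, the values at $z$ are formed along $\gamma|_{[0,t_0]}$ followed by $c$ for $k=j$, and along the reversed path of $\gamma|_{[t_0,1]}$ followed by $c$ for $k=i$. *Multiple zeta values.* In a punctured coordinate disc at $P_i$ that contains no other puncture, consider the determinations obtained from $t_0$ close to $1$ and $c$ in the punctured disc, and let $\log u(z)$ be the branch continued along $c$. $\mathrm{MZV}_{i,j}(v)$ is the number $\lim_{z\to P_i}a_0(z)$ for an expansion $\mathrm{Li}_{v,j}(z)=\sum_{s=0}^t a_s(z)\,(\log u(z))^s$, valid for all these determinations, whose coefficients $a_s$ are holomorphic functions on the disc. Then: 1. All the limits above exist. 2. The coefficients $\Phi_{i,j}(v)$ of $\Phi_{i,j}=L_i(z)^{-1}L_j(z)$ are independent of $z$ (and of $t_0$ and $c$). 3. For $a\ge0$ and every word $v'$ that does not begin with $w_i$, $$\Phi_{i,j}(w_i^a v')=\lim_{z\to P_i}\sum_{k=0}^a(-\rho_i)^k\,\frac{(\log u(z))^k}{k!}\,\mathrm{Li}_{w_i^{a-k}v',j}(z),$$ where $z\to P_i$ with $\operatorname{Im}\log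 u(z)$ bounded. 4. For every word $v$ an expansion as above exists, so that $\mathrm{MZV}_{i,j}(v)$ is defined; its value does not depend on the expansion, and $\Phi_{i,j}(v)=\mathrm{MZV}_{i,j}(v)$. -/

import Mathlib

open Set Filter Topology
open scoped Manifold ContDiff

noncomputable section

/-! ### Words, shuffle product, shuffle decomposition -/

section Words

variable {ι : Type*}

/-- The shuffle product of two words, a formal `ℂ`-linear combination of words. -/
def shuffle : List ι → List ι → (List ι →₀ ℂ)
  | [], v => Finsupp.single v 1
  | a :: u, [] => Finsupp.single (a :: u) 1
  | a :: u, b :: v =>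
      (shuffle u (b :: v)).mapDomain (List.cons a) + (shuffle (a :: u) v).mapDomain (List.cons b)
termination_by u v => u.length + v.length

/-- The shuffle product of a generalized word (a linear combination of words) with a word. -/
def shuffleWord (q : List ι →₀ ℂ) (v : List ι) : List ι →₀ ℂ :=
  q.sum fun u c => c • shuffle u v

/-- `D` is a decomposition `p = ∑ i, D i ⧢ j ^ i` of the generalized word `p`, where no word that
occurs in one of the `D i` ends in the letter `j`. -/
def IsShuffleDecomp (j : ι) (p : List ι →₀ ℂ) (D : ℕ →₀ (List ι →₀ ℂ)) : Prop :=
  (∀ i, ∀ v ∈ (D i).support, ¬ [j] <:+ v) ∧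
    p = D.sum fun i q => shuffleWord q (List.replicate i j)

lemma mapDomain_cons_nil (a : ι) (q : List ι →₀ ℂ) : q.mapDomain (List.cons a) [] = 0 :=
  Finsupp.mapDomain_of_notMem_range _ _ (by simp)

open Classical in
lemma mapDomain_cons_cons (a b : ι) (q : List ι →₀ ℂ) (x : List ι) :
    q.mapDomain (List.cons a) (b :: x) = if a = b then q x else 0 := by
  split_ifs with h
  · subst h; exact Finsupp.mapDomain_apply (List.cons_injective) _ _
  · exact Finsupp.mapDomain_of_notMem_range _ _ (by simpa using h)

lemma shuffle_nil_right (u : List ι) : shuffle u [] = Finsupp.single u 1 := by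
  cases u <;> simp [shuffle]

lemma shuffle_apply_nil (u v : List ι) (h : v ≠ []) : shuffle u v [] = 0 := by
  cases u with
  | nil => simp [shuffle, h]
  | cons a u =>
    cases v with
    | nil => exact absurd rfl h
    | cons b v => simp [shuffle, mapDomain_cons_nil]

lemma shuffle_append_apply (j : ι) (n : ℕ) : ∀ u v x : List ι, u.length + v.length ≤ n →
    ¬ [j] <:+ u → shuffle u (v ++ [j]) (x ++ [j]) = shuffle u v x := by
  classical
  induction n with
  | zero =>
    intro u v x h _
    obtain rfl : u = [] := List.length_eq_zero_iff.1 (by omega)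
    simp [shuffle, Finsupp.single_apply]
  | succ n ih =>
    intro u v x h hu
    cases u with
    | nil => simp [shuffle, Finsupp.single_apply]
    | cons a u =>
      have hu' : ¬ [j] <:+ u := fun h' => hu (h'.trans (List.suffix_cons a u))
      simp only [List.length_cons] at h
      cases v with
      | nil =>
        cases x with
        | nil => simp [shuffle, mapDomain_cons_cons, shuffle_apply_nil]
        | cons b x =>
          have h0 : a :: u ≠ x ++ [j] := fun e => hu (e ▸ List.suffix_append x [j])
          have := ih u [] x (by simp at h ⊢; omega) hu'
          simp only [List.nil_append, shuffle_nil_right] at this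
          simp only [List.nil_append, shuffle, List.cons_append, Finsupp.add_apply,
            mapDomain_cons_cons, this, shuffle_nil_right]
          simp [Finsupp.single_apply, h0]
          aesop
      | cons b v =>
        simp only [List.length_cons] at h
        cases x with
        | nil =>
          simp [shuffle, mapDomain_cons_cons, mapDomain_cons_nil, shuffle_apply_nil]
        | cons c x =>
          have h1 := ih u (b :: v) x (by simp; omega) hu'
          have h2 := ih (a :: u) v x (by simp; omega) hu
          simp only [List.cons_append] at h1
          simp only [List.cons_append, shuffle, Finsupp.add_apply, mapDomain_cons_cons, h1, h2]

/-- Removing a last letter `j` (words not ending in `j` are sent to `0`). -/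
def dropLetter (j : ι) (p : List ι →₀ ℂ) : List ι →₀ ℂ :=
  p.comapDomain (fun v => v ++ [j]) (fun _ _ _ _ h => List.append_cancel_right h)

lemma dropLetter_apply (j : ι) (p : List ι →₀ ℂ) (x : List ι) :
    dropLetter j p x = p (x ++ [j]) := rfl

lemma dropLetter_add (j : ι) (p q : List ι →₀ ℂ) :
    dropLetter j (p + q) = dropLetter j p + dropLetter j q := by
  ext x; simp [dropLetter_apply]

lemma dropLetter_sub (j : ι) (p q : List ι →₀ ℂ) :
    dropLetter j (p - q) = dropLetter j p - dropLetter j q := by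
  ext x; simp [dropLetter_apply]

lemma shuffleWord_nil (q : List ι →₀ ℂ) : shuffleWord q [] = q := by
  simp [shuffleWord, shuffle_nil_right]

lemma shuffleWord_zero (v : List ι) : shuffleWord (0 : List ι →₀ ℂ) v = 0 := by
  simp [shuffleWord]

lemma shuffleWord_add (p q : List ι →₀ ℂ) (v : List ι) :
    shuffleWord (p + q) v = shuffleWord p v + shuffleWord q v :=
  Finsupp.sum_add_index' (by simp) (by simp [add_smul])

lemma shuffleWord_apply (q : List ι →₀ ℂ) (v x : List ι) :
    shuffleWord q v x = q.sum fun u c => c * shuffle u v x := by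
  simp [shuffleWord, Finsupp.sum_apply]

lemma dropLetter_eq_zero {j : ι} {q : List ι →₀ ℂ} :
    dropLetter j q = 0 ↔ ∀ v ∈ q.support, ¬ [j] <:+ v := by
  constructor
  · rintro h v hv ⟨x, rfl⟩
    exact Finsupp.mem_support_iff.1 hv (by rw [← dropLetter_apply, h]; rfl)
  · intro h
    ext x
    by_contra h0
    exact h (x ++ [j]) (Finsupp.mem_support_iff.2 h0) (List.suffix_append _ _)

lemma dropLetter_shuffleWord {j : ι} {q : List ι →₀ ℂ} (hq : dropLetter j q = 0) (m : ℕ) :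
    dropLetter j (shuffleWord q (List.replicate (m + 1) j)) =
      shuffleWord q (List.replicate m j) := by
  ext x
  rw [dropLetter_apply, shuffleWord_apply, shuffleWord_apply]
  refine Finset.sum_congr rfl fun u hu => ?_
  simp only
  rw [List.replicate_succ', shuffle_append_apply j _ _ _ _ le_rfl (dropLetter_eq_zero.1 hq u hu)]

lemma dropLetter_iterate_shuffleWord {j : ι} {q : List ι →₀ ℂ} (hq : dropLetter j q = 0) (m : ℕ) :
    (dropLetter j)^[m] (shuffleWord q (List.replicate m j)) = q := by
  induction m with
  | zero => simp [shuffleWord_nil]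
  | succ m ih => rw [Function.iterate_succ_apply, dropLetter_shuffleWord hq, ih]

lemma dropLetter_iterate_add (j : ι) (m : ℕ) (p q : List ι →₀ ℂ) :
    (dropLetter j)^[m] (p + q) = (dropLetter j)^[m] p + (dropLetter j)^[m] q := by
  induction m generalizing p q with
  | zero => rfl
  | succ m ih => simp [Function.iterate_succ_apply, dropLetter_add, ih]

lemma dropLetter_iterate_sub (j : ι) (m : ℕ) (p q : List ι →₀ ℂ) :
    (dropLetter j)^[m] (p - q) = (dropLetter j)^[m] p - (dropLetter j)^[m] q := by
  induction m generalizing p q with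
  | zero => rfl
  | succ m ih => simp [Function.iterate_succ_apply, dropLetter_sub, ih]

lemma dropLetter_iterate_apply (j : ι) (m : ℕ) (p : List ι →₀ ℂ) (x : List ι) :
    (dropLetter j)^[m] p x = p (x ++ List.replicate m j) := by
  induction m generalizing p with
  | zero => simp
  | succ m ih =>
    rw [Function.iterate_succ_apply, ih, dropLetter_apply, List.append_assoc,
      ← List.replicate_succ']

lemma exists_isShuffleDecomp_aux (j : ι) (n : ℕ) : ∀ p : List ι →₀ ℂ,
    (dropLetter j)^[n] p = 0 → ∃ D, IsShuffleDecomp j p D := by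
  induction n with
  | zero =>
    intro p hp
    refine ⟨0, by simp, ?_⟩
    simpa using hp
  | succ n ih =>
    intro p hp
    set q := (dropLetter j)^[n] p with hq
    have hq0 : dropLetter j q = 0 := by
      rw [hq, ← Function.iterate_succ_apply' (dropLetter j) n p, hp]
    obtain ⟨D, hD, hpD⟩ := ih (p - shuffleWord q (List.replicate n j)) (by
      rw [dropLetter_iterate_sub, dropLetter_iterate_shuffleWord hq0, sub_self])
    refine ⟨D + Finsupp.single n q, ?_, ?_⟩
    · intro i
      rw [← dropLetter_eq_zero, Finsupp.add_apply, dropLetter_add,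
        dropLetter_eq_zero.2 (hD i), zero_add]
      by_cases h : n = i
      · subst h; simpa using hq0
      · rw [Finsupp.single_eq_of_ne (Ne.symm h)]; ext; rfl
    · rw [Finsupp.sum_add_index' (by simp [shuffleWord_zero]) (by simp [shuffleWord_add]), ← hpD,
        Finsupp.sum_single_index (h := fun i q => shuffleWord q (List.replicate i j))
          (shuffleWord_zero _), sub_add_cancel]

/-- Every generalized word has a shuffle decomposition. -/
theorem exists_isShuffleDecomp (j : ι) (p : List ι →₀ ℂ) : ∃ D, IsShuffleDecomp j p D := by
  refine exists_isShuffleDecomp_aux j (p.support.sup List.length + 1) p ?_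
  ext x
  rw [dropLetter_iterate_apply]
  by_contra h
  have := Finset.le_sup (f := List.length) (Finsupp.mem_support_iff.2 h)
  rw [List.length_append, List.length_replicate] at this
  omega

/-- The shuffle decomposition of a word `w` with respect to the letter `j`: the generalized words
`w(i)` with `w = ∑ i, w(i) ⧢ j ^ i`. -/
def shuffleDecomp (j : ι) (w : List ι) : ℕ →₀ (List ι →₀ ℂ) :=
  (exists_isShuffleDecomp j (Finsupp.single w 1)).choose

theorem isShuffleDecomp_shuffleDecomp (j : ι) (w : List ι) :
    IsShuffleDecomp j (Finsupp.single w 1) (shuffleDecomp j w) :=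
  (exists_isShuffleDecomp j (Finsupp.single w 1)).choose_spec

lemma IsShuffleDecomp.top_eq {j : ι} {p : List ι →₀ ℂ} {D : ℕ →₀ (List ι →₀ ℂ)}
    (h : IsShuffleDecomp j p D) {n : ℕ} (hn : ∀ i, n < i → D i = 0) :
    (dropLetter j)^[n] p = D n := by
  let f : (List ι →₀ ℂ) →+ (List ι →₀ ℂ) :=
    { toFun := (dropLetter j)^[n]
      map_zero' := by ext x; simp [dropLetter_iterate_apply]
      map_add' := dropLetter_iterate_add j n }
  have hf : ∀ q, f q = (dropLetter j)^[n] q := fun _ => rfl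
  rw [h.2, ← hf, Finsupp.sum, map_sum]
  have hq : ∀ i, dropLetter j (D i) = 0 := fun i => dropLetter_eq_zero.2 (h.1 i)
  rw [Finset.sum_eq_single n]
  · rw [hf, dropLetter_iterate_shuffleWord (hq n)]
  · intro i hi hin
    have hlt : i < n := by
      rcases lt_or_gt_of_ne hin with h' | h'
      · exact h'
      · exact absurd (hn i h') (Finsupp.mem_support_iff.1 hi)
    obtain ⟨k, rfl⟩ := Nat.exists_eq_add_of_lt hlt
    rw [hf, show i + k + 1 = k + 1 + i by omega, Function.iterate_add_apply,
      dropLetter_iterate_shuffleWord (hq i), Function.iterate_succ_apply, hq i]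
    ext x; simp [dropLetter_iterate_apply]
  · intro hi
    rw [Finsupp.notMem_support_iff.1 hi, shuffleWord_zero, map_zero]

/-- The shuffle decomposition is unique. -/
theorem IsShuffleDecomp.unique {j : ι} {p : List ι →₀ ℂ} {D D' : ℕ →₀ (List ι →₀ ℂ)}
    (h : IsShuffleDecomp j p D) (h' : IsShuffleDecomp j p D') : D = D' := by
  suffices H : ∀ n : ℕ, ∀ (p : List ι →₀ ℂ) (D D' : ℕ →₀ (List ι →₀ ℂ)),
      IsShuffleDecomp j p D → IsShuffleDecomp j p D' →
      (∀ i, n ≤ i → D i = 0) → (∀ i, n ≤ i → D' i = 0) → D = D' by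
    refine H (D.support.sup id + D'.support.sup id + 1) p D D' h h' ?_ ?_ <;>
    · intro i hi
      by_contra h0
      have := Finset.le_sup (f := id) (Finsupp.mem_support_iff.2 h0)
      simp only [id] at this
      omega
  intro n
  induction n with
  | zero =>
    intro p D D' _ _ h1 h2
    ext1 i
    rw [h1 i (Nat.zero_le _), h2 i (Nat.zero_le _)]
  | succ n ih =>
    intro p D D' h h' h1 h2
    have e : D n = D' n := by rw [← h.top_eq (fun i hi => h1 i hi), h'.top_eq (fun i hi => h2 i hi)]
    have key : ∀ E : ℕ →₀ (List ι →₀ ℂ), IsShuffleDecomp j p E →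
        IsShuffleDecomp j (p - shuffleWord (E n) (List.replicate n j)) (E.erase n) := by
      intro E hE
      refine ⟨fun i => ?_, ?_⟩
      · by_cases hi : i = n
        · subst hi; simp
        · rw [Finsupp.erase_ne hi]; exact hE.1 i
      · conv_lhs => rw [hE.2, ← Finsupp.add_sum_erase' E n _ (by simp [shuffleWord_zero])]
        rw [add_sub_cancel_left]
    have hk := key D h
    rw [e] at hk
    have := ih _ _ _ hk (key D' h') ?_ ?_
    · rw [← Finsupp.single_add_erase n D, ← Finsupp.single_add_erase n D', this, e]
    all_goals
      intro i hi
      by_cases hin : i = n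
      · subst hin; simp
      · rw [Finsupp.erase_ne hin]
        first | exact h1 i (by omega) | exact h2 i (by omega)

end Words

/-! ### Formal power series in non-commuting variables -/

section Series

/-- Formal power series over `ℂ` in free non-commuting variables `x_k`, `k : ι`; the series
`∑ f(v) x_v` is given by its coefficient function. -/
def NCSeries (ι : Type*) : Type _ := List ι → ℂ

namespace NCSeries

variable {ι : Type*}

instance : One (NCSeries ι) := ⟨fun v => if v.isEmpty then 1 else 0⟩

instance : Mul (NCSeries ι) :=
  ⟨fun f g v => ∑ n ∈ Finset.range (v.length + 1), f (v.take n) * g (v.drop n)⟩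

/-- The coefficients of the inverse series. -/
def invCoeff (f : List ι → ℂ) : List ι → ℂ
  | [] => (f [])⁻¹
  | a :: v => -(f [])⁻¹ *
      ∑ n ∈ Finset.range (v.length + 1), f (a :: v.take n) * invCoeff f (v.drop n)
termination_by v => v.length
decreasing_by simp

/-- The inverse of a series (for series with non-zero constant term). -/
instance : Inv (NCSeries ι) := ⟨fun f => invCoeff f⟩

theorem mul_apply (f g : NCSeries ι) (v : List ι) :
    (f * g) v = ∑ n ∈ Finset.range (v.length + 1), f (v.take n) * g (v.drop n) := rfl

theorem invCoeff_nil (f : List ι → ℂ) : invCoeff f [] = (f [])⁻¹ := by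
  rw [invCoeff]

theorem invCoeff_cons (f : List ι → ℂ) (a : ι) (v : List ι) :
    invCoeff f (a :: v) = -(f [])⁻¹ *
      ∑ n ∈ Finset.range (v.length + 1), f (a :: v.take n) * invCoeff f (v.drop n) := by
  rw [invCoeff]

theorem mul_inv_self (f : NCSeries ι) (hf : f [] ≠ 0) : f * f⁻¹ = 1 := by
  have h0 : f⁻¹ [] = (f [])⁻¹ := invCoeff_nil f
  have h1 : ∀ a v, f⁻¹ (a :: v) = -(f [])⁻¹ *
      ∑ n ∈ Finset.range (v.length + 1), f (a :: v.take n) * f⁻¹ (v.drop n) := invCoeff_cons f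
  funext v
  rw [mul_apply]
  cases v with
  | nil =>
    change _ = (1 : ℂ)
    simp only [List.length_nil, zero_add, Finset.sum_range_one, List.take_nil, List.drop_nil, h0]
    exact mul_inv_cancel₀ hf
  | cons a v =>
    change _ = (0 : ℂ)
    rw [List.length_cons, Finset.sum_range_succ']
    simp only [List.take_succ_cons, List.drop_succ_cons, List.take_zero, List.drop_zero, h1]
    rw [← mul_assoc, mul_neg, mul_inv_cancel₀ hf]
    ring

end NCSeries

end Series

/-! ### Holomorphic one-forms on a Riemann surface -/

section Forms

variable {X : Type*} [TopologicalSpace X] [ChartedSpace ℂ X]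

/-- A (not necessarily continuous) `(1,0)`-form: a complex linear form on every tangent line. -/
abbrev OneForm (X : Type*) [TopologicalSpace X] [ChartedSpace ℂ X] : Type _ :=
  ∀ x : X, TangentSpace 𝓘(ℂ) x →L[ℂ] ℂ

/-- The coefficient `f` of the form `η = f(u) du` in a local coordinate `u = e`. -/
def OneForm.coeff (η : OneForm X) (e : OpenPartialHomeomorph X ℂ) (u : ℂ) : ℂ :=
  η (e.symm u) (mfderiv 𝓘(ℂ) 𝓘(ℂ) e.symm u (1 : ℂ))

/-- `η` is a holomorphic one-form on `U`: its coefficient in every holomorphic chart is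
holomorphic. -/
def OneForm.IsHolomorphicOn (η : OneForm X) (U : Set X) : Prop :=
  ∀ e ∈ IsManifold.maximalAtlas 𝓘(ℂ) ω X,
    DifferentiableOn ℂ (η.coeff e) (e.target ∩ e.symm ⁻¹' U)

/-- `η` has a simple pole at `P`. -/
def OneForm.HasSimplePoleAt (η : OneForm X) (P : X) : Prop :=
  ∀ e ∈ IsManifold.maximalAtlas 𝓘(ℂ) ω X, P ∈ e.source →
    meromorphicOrderAt (η.coeff e) (e P) = -1

/-- `η` extends holomorphically across the (possibly removable) singularity `P`. -/
def OneForm.IsRegularAt (η : OneForm X) (P : X) : Prop :=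
  ∀ e ∈ IsManifold.maximalAtlas 𝓘(ℂ) ω X, P ∈ e.source →
    MeromorphicAt (η.coeff e) (e P) ∧ 0 ≤ meromorphicOrderAt (η.coeff e) (e P)

/-- The residue of `η` at a simple pole, in a local coordinate `u = e` with `u = 0` at the pole. -/
def OneForm.residue (η : OneForm X) (e : OpenPartialHomeomorph X ℂ) : ℂ :=
  limUnder (𝓝[≠] (0 : ℂ)) fun u => u * η.coeff e u

/-- `P` is a good puncture for the forms `w`, and `k` is the index of the only form with a pole
at `P`: this pole is simple, and the other forms are holomorphic at `P`. -/
def IsGoodPuncture {ι : Type*} (w : ι → OneForm X) (P : X) (k : ι) : Prop :=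
  (w k).HasSimplePoleAt P ∧ ∀ l, l ≠ k → (w l).IsRegularAt P

/-! ### Paths and iterated integrals -/

/-- The velocity of a path in `X`, as a tangent vector. -/
def velocity (γ : ℝ → X) (t : ℝ) : TangentSpace 𝓘(ℂ) (γ t) :=
  (mfderiv 𝓘(ℝ, ℝ) 𝓘(ℝ, ℂ) γ t (1 : ℝ) : ℂ)

/-- The function `g` in `γ^* η = g dt`. -/
def OneForm.pullback (η : OneForm X) (γ : ℝ → X) (t : ℝ) : ℂ :=
  η (γ t) (velocity γ t)

/-- The iterated integral over the piece of `γ` between the times `ε` and `T` that belongs to the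
word `w₁ ⋯ wᵣ`, i.e. `∫_{ε ≤ t₁ ≤ ⋯ ≤ tᵣ ≤ T} g_r(t₁) dt₁ ⋯ g₁(tᵣ) dtᵣ`: the first letter is
integrated last. -/
def iterInt {ι : Type*} (w : ι → OneForm X) (γ : ℝ → X) (ε : ℝ) : List ι → ℝ → ℂ
  | [], _ => 1
  | k :: v, T => ∫ s in ε..T, (w k).pullback γ s * iterInt w γ ε v s

/-- The reversed path. -/
def reversePath (γ : ℝ → X) : ℝ → X := fun t => γ (1 - t)

/-- The path that follows `γ` up to the time `t₀` and then follows `c`. -/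
def followPath (γ : ℝ → X) (t₀ : ℝ) (c : ℝ → X) : ℝ → X :=
  fun t => if t ≤ t₀ then γ t else c (t - t₀)

/-- A path in the compact surface from `P` to `Q`, parametrized by `[0, 1]`, which is smooth (`C¹`)
and avoids the punctures `S` in the interior of its parameter interval. -/
structure IsPuncturePath (S : Set X) (P Q : X) (γ : ℝ → X) : Prop where
  continuousOn : ContinuousOn γ (Icc 0 1)
  source : γ 0 = P
  target : γ 1 = Q
  contMDiffOn : ContMDiffOn 𝓘(ℝ, ℝ) 𝓘(ℝ, ℂ) 1 γ (Ioo 0 1)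
  notMem : ∀ t ∈ Ioo (0 : ℝ) 1, γ t ∉ S

/-- Regularization data at the puncture `P` for a path `γ` that starts at `P`: a local coordinate
`chart` at `P`, a coordinate disc `|u| < radius` which contains no other puncture, and a continuous
branch `log` of the logarithm of the coordinate along the initial piece `0 < t < time` of `γ`,
with bounded imaginary part (the path does not spiral infinitely around `P`; this holds if
the path has a non-zero tangent vector at `P`). -/
structure BaseDatum (S : Set X) (P : X) (γ : ℝ → X) where
  chart : OpenPartialHomeomorph X ℂ
  chart_mem : chart ∈ IsManifold.maximalAtlas 𝓘(ℂ) ω X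
  mem_source : P ∈ chart.source
  chart_eq : chart P = 0
  radius : ℝ
  radius_pos : 0 < radius
  ball_subset : Metric.ball 0 radius ⊆ chart.target
  eq_of_mem : ∀ Q ∈ S, Q ∈ chart.source → chart Q ∈ Metric.ball 0 radius → Q = P
  time : ℝ
  time_pos : 0 < time
  time_le : time ≤ 1
  mapsTo : ∀ t ∈ Ioo 0 time, γ t ∈ chart.source ∧ chart (γ t) ∈ Metric.ball 0 radius
  log : ℝ → ℂ
  log_continuousOn : ContinuousOn log (Ioo 0 time)
  exp_log : ∀ t ∈ Ioo 0 time, Complex.exp (log t) = chart (γ t)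
  log_bounded : ∃ B : ℝ, ∀ t ∈ Ioo 0 time, |(log t).im| ≤ B

/-! ### Shuffle regularization -/

section Regularization

variable {ι : Type*} (w : ι → OneForm X) (k : ι) (ρ : ℂ) (log : ℝ → ℂ) (α : ℝ → X) (T : ℝ)

/-- The regularized integral of the form `w k` (with a simple pole of residue `ρ` at the starting
point of `α`), where `log ε` is the logarithm of the local coordinate of `α ε`. -/
def regInt : ℂ :=
  limUnder (𝓝[>] (0 : ℝ)) fun ε => ρ * log ε + iterInt w α ε [k] T

/-- The iterated integral over `α`, up to the time `T`, of a word which does not end in `k`. -/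
def convInt (v : List ι) : ℂ :=
  limUnder (𝓝[>] (0 : ℝ)) fun ε => iterInt w α ε v T

/-- The limits which define `regInt` and `convInt` exist. -/
def RegularizationConverges : Prop :=
  (∃ l, Tendsto (fun ε => ρ * log ε + iterInt w α ε [k] T) (𝓝[>] (0 : ℝ)) (𝓝 l)) ∧
    ∀ v : List ι, ¬ [k] <:+ v → ∃ l, Tendsto (fun ε => iterInt w α ε v T) (𝓝[>] (0 : ℝ)) (𝓝 l)

/-- The generating series `∑ Li_v x_v` of the shuffle-regularized iterated integrals over `α` up to
the time `T`: if `v = ∑ i, v(i) ⧢ k ^ i` where the `v(i)` do not end in `k`, then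
`Li_v = ∑ i, (∫ w_k) ^ i / i! * Li_{v(i)}`. -/
def regSeries : NCSeries ι := fun v =>
  (shuffleDecomp k v).sum fun i q =>
    regInt w k ρ log α T ^ i / (i.factorial : ℂ) * q.sum fun u a => a * convInt w α T u

end Regularization

/-! ### The variable point -/

/-- A point `z` of the punctured surface together with a determination of the multi-valued
functions at `z`: it is reached from a point `γ time` of the path `γ` by analytic continuation
along a smooth path `c` in the punctured surface which ends at `z = c 1`. -/
structure Continuation (S : Set X) (γ : ℝ → X) where
  time : ℝ
  time_mem : time ∈ Ioo (0 : ℝ) 1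
  c : ℝ → X
  contMDiffOn : ContMDiffOn 𝓘(ℝ, ℝ) 𝓘(ℝ, ℂ) 1 c (Icc 0 1)
  start : c 0 = γ time
  notMem : ∀ s ∈ Icc (0 : ℝ) 1, c s ∉ S

variable {S : Set X} {P Q : X} {γ : ℝ → X}

/-- A determination at a point `z` of the punctured coordinate disc of the end point `P` of `γ`,
reached from a point on the last piece of `γ` by continuation inside the punctured disc, together
with the continuation `log` of the logarithm of the local coordinate. -/
structure NearEnd (b : BaseDatum S P (reversePath γ)) extends Continuation S γ where
  late : 1 - time < b.time
  mapsTo : ∀ s ∈ Icc (0 : ℝ) 1, c s ∈ b.chart.source ∧ b.chart (c s) ∈ Metric.ball 0 b.radius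
  log : ℝ → ℂ
  log_continuousOn : ContinuousOn log (Icc 0 1)
  exp_log : ∀ s ∈ Icc (0 : ℝ) 1, Complex.exp (log s) = b.chart (c s)
  log_start : log 0 = b.log (1 - time)

/-- The local coordinate of the point `z`. -/
def NearEnd.coord {b : BaseDatum S P (reversePath γ)} (κ : NearEnd b) : ℂ := b.chart (κ.c 1)

/-- The logarithm of the local coordinate of the point `z`. -/
def NearEnd.logCoord {b : BaseDatum S P (reversePath γ)} (κ : NearEnd b) : ℂ := κ.log 1

/-- `z → P`, in such a way that the argument of the coordinate is bounded by `B`. -/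
def nearEndFilter (b : BaseDatum S P (reversePath γ)) (B : ℝ) : Filter (NearEnd b) :=
  comap NearEnd.coord (𝓝 0) ⊓ 𝓟 {κ | |κ.logCoord.im| ≤ B}

variable {ι : Type*} (w : ι → OneForm X) (k : ι)

/-- The limits which define the series `startSeries` at the determination `κ` exist. -/
def StartConverges (b : BaseDatum S P γ) (κ : Continuation S γ) : Prop :=
  RegularizationConverges w k ((w k).residue b.chart) b.log (followPath γ κ.time κ.c) (κ.time + 1)

/-- The series `L_P(z)` for the starting point `P` of `γ`: the path of integration is `γ` up to the
time `κ.time`, followed by `κ.c`. -/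
def startSeries (b : BaseDatum S P γ) (κ : Continuation S γ) : NCSeries ι :=
  regSeries w k ((w k).residue b.chart) b.log (followPath γ κ.time κ.c) (κ.time + 1)

/-- The limits which define the series `endSeries` at the determination `κ` exist. -/
def EndConverges (b : BaseDatum S P (reversePath γ)) (κ : Continuation S γ) : Prop :=
  RegularizationConverges w k ((w k).residue b.chart) b.log
    (followPath (reversePath γ) (1 - κ.time) κ.c) (1 - κ.time + 1)

/-- The series `L_P(z)` for the end point `P` of `γ`: the path of integration is the reversed path
of `γ` from `P` to the point `γ κ.time`, followed by `κ.c`. -/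
def endSeries (b : BaseDatum S P (reversePath γ)) (κ : Continuation S γ) : NCSeries ι :=
  regSeries w k ((w k).residue b.chart) b.log
    (followPath (reversePath γ) (1 - κ.time) κ.c) (1 - κ.time + 1)

/-- `m` is the regularized limit at `P` of the multi-valued function `f`: in the punctured
coordinate disc `f(z) = ∑_{s ≤ t} a_s(z) log(z) ^ s`, where the `a_s` are holomorphic functions of
the local coordinate, and `m = lim_{z → P} a_0(z)`. -/
def IsRegularizedLimit (b : BaseDatum S P (reversePath γ)) (f : Continuation S γ → ℂ) (m : ℂ) :
    Prop :=
  ∃ (t : ℕ) (a : ℕ → ℂ → ℂ),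
    (∀ s, DifferentiableOn ℂ (a s) (Metric.ball 0 b.radius)) ∧
    (∀ κ : NearEnd b, f κ.toContinuation =
      ∑ s ∈ Finset.range (t + 1), a s κ.coord * κ.logCoord ^ s) ∧
    Tendsto (a 0) (𝓝[≠] (0 : ℂ)) (𝓝 m)

/-- `m` is the generalized multiple zeta value `MZV_{i,j}(v)`: the regularized limit of `Li_{v,j}`
at the end point `P_i` of `γ`. -/
def IsMZV (bj : BaseDatum S Q γ) (bi : BaseDatum S P (reversePath γ)) (v : List ι) (m : ℂ) : Prop :=
  IsRegularizedLimit bi (fun κ => startSeries w k bj κ v) m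

end Forms

end

/-! The generating series of iterated integrals along a path solves dF = (∑ w_a x_a) F. The system
is triangular in word length, so a solution is fixed by its value at one point. At a good puncture
with coordinate u and residue ρ the equation is Fuchsian and has the solution F = H(u) exp(ρ log u ·
x_k) with H holomorphic and H(0) = 1 (`poleSeries_spec`, `IsPoleSolution.isSolution`).

The integrals from ε to T form the series F(T) F(ε)⁻¹ = F(T) exp(-ρ log ε · x_k) H(ε)⁻¹, where
H(ε)⁻¹ - 1 tends to zero faster than any power of log ε grows. Hence words not ending in k converge
to the coefficients of F(T), and so does the letter k once ρ log ε is added. By induction on length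
the shuffle defects of F are constant along the path, and they vanish in the limit because F is
asymptotic to a group-like exponential (`isGroupLike_of_asymptotics`). So F(T) is group-like, and
shuffle regularization returns F(T) at every word (`regularizationConverges_and_regSeries_eq`).

Therefore L_i and L_j solve the same equation along γ, and L_j = L_i Φ with Φ constant. Near P_i
this reads L_j = H(u) exp(ρ_i log u · x_i) Φ. Expanding the exponential gives a polynomial in log u
with holomorphic coefficients, whose log-free part H(u) Φ tends to Φ; multiplying by exp(-ρ_i log u
· x_i) on the left gives the limit formula. The log-free part is unique because infinitely many
values of log u occur over the same point (`IsRegularizedLimit.unique`). -/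

noncomputable section

/-! ### The algebra of series -/

namespace NCSeries

variable {ι : Type*}

instance : AddCommGroup (NCSeries ι) := inferInstanceAs (AddCommGroup (List ι → ℂ))

instance : Module ℂ (NCSeries ι) := inferInstanceAs (Module ℂ (List ι → ℂ))

@[ext] theorem ext {f g : NCSeries ι} (h : ∀ v, f v = g v) : f = g := funext h

theorem add_apply (f g : NCSeries ι) (v : List ι) : (f + g) v = f v + g v := rfl
theorem sub_apply (f g : NCSeries ι) (v : List ι) : (f - g) v = f v - g v := rfl
theorem zero_apply (v : List ι) : (0 : NCSeries ι) v = 0 := rfl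
theorem smul_apply (c : ℂ) (f : NCSeries ι) (v : List ι) : (c • f) v = c * f v := rfl
theorem one_nil : (1 : NCSeries ι) [] = 1 := rfl
theorem one_cons (a : ι) (v : List ι) : (1 : NCSeries ι) (a :: v) = 0 := rfl

theorem one_of_ne {v : List ι} (h : v ≠ []) : (1 : NCSeries ι) v = 0 := by
  cases v with
  | nil => exact absurd rfl h
  | cons a v => rfl

theorem mul_nil (f g : NCSeries ι) : (f * g) [] = f [] * g [] := by
  simp [mul_apply]

/-- The series of the coefficients of the words that begin with `a`. -/
def tail (a : ι) (f : NCSeries ι) : NCSeries ι := fun v => f (a :: v)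

theorem mul_cons (f g : NCSeries ι) (a : ι) (v : List ι) :
    (f * g) (a :: v) = f [] * g (a :: v) + (tail a f * g) v := by
  rw [mul_apply, List.length_cons, Finset.sum_range_succ', add_comm]
  simp [mul_apply, tail]

protected theorem add_mul (f g h : NCSeries ι) : (f + g) * h = f * h + g * h := by
  ext v
  simp only [mul_apply, add_apply, _root_.add_mul, Finset.sum_add_distrib]

protected theorem mul_add (f g h : NCSeries ι) : f * (g + h) = f * g + f * h := by
  ext v
  simp only [mul_apply, add_apply, _root_.mul_add, Finset.sum_add_distrib]

/-- Induction on the word through the first-letter rule `mul_cons`, which avoids reindexing a double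
sum over splittings. -/
protected theorem mul_assoc (f g h : NCSeries ι) : f * g * h = f * (g * h) := by
  ext v
  induction v generalizing f g with
  | nil => simp only [mul_nil]; ring
  | cons a v ih =>
    have e : tail a (f * g) = f [] • tail a g + tail a f * g := by
      ext w; exact mul_cons f g a w
    have e2 : ((f [] • tail a g) * h) v = f [] * (tail a g * h) v := by
      simp only [mul_apply, Finset.mul_sum, smul_apply, _root_.mul_assoc]
    rw [mul_cons, e, NCSeries.add_mul, add_apply, e2, ih, mul_cons f, mul_cons g, mul_nil]
    ring

protected theorem one_mul (f : NCSeries ι) : 1 * f = f := by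
  ext v
  rw [mul_apply, Finset.sum_range_succ', Finset.sum_eq_zero, zero_add]
  · rw [List.take_zero, one_nil, List.drop_zero, _root_.one_mul]
  · intro n hn
    rw [one_of_ne, zero_mul]
    rw [Finset.mem_range] at hn
    intro h
    have := congrArg List.length h
    simp at this
    subst this
    simp at hn

protected theorem mul_one (f : NCSeries ι) : f * 1 = f := by
  ext v
  rw [mul_apply, Finset.sum_range_succ, Finset.sum_eq_zero, zero_add]
  · rw [List.take_length, List.drop_length, one_nil, _root_.mul_one]
  · intro n hn
    rw [one_of_ne, mul_zero]
    rw [Finset.mem_range] at hn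
    simpa using hn

instance : Ring (NCSeries ι) where
  __ := (inferInstance : AddCommGroup (NCSeries ι))
  mul_assoc := NCSeries.mul_assoc
  one_mul := NCSeries.one_mul
  mul_one := NCSeries.mul_one
  left_distrib := NCSeries.mul_add
  right_distrib := NCSeries.add_mul
  zero_mul f := by ext v; simp [mul_apply, zero_apply]
  mul_zero f := by ext v; simp [mul_apply, zero_apply]

instance : Algebra ℂ (NCSeries ι) :=
  Algebra.ofModule
    (fun c f g => by ext v; simp only [mul_apply, smul_apply, Finset.mul_sum, _root_.mul_assoc])
    (fun c f g => by ext v; simp only [mul_apply, smul_apply, Finset.mul_sum, mul_left_comm])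

theorem inv_nil (f : NCSeries ι) : f⁻¹ [] = (f [])⁻¹ := invCoeff_nil f

theorem inv_cons (f : NCSeries ι) (a : ι) (v : List ι) :
    f⁻¹ (a :: v) = -(f [])⁻¹ * (tail a f * f⁻¹) v := invCoeff_cons f a v

/-- Right inverses exist for `f` and for `f⁻¹`, so `f = f⁻¹⁻¹`. -/
theorem inv_mul_self (f : NCSeries ι) (hf : f [] ≠ 0) : f⁻¹ * f = 1 := by
  have h := mul_inv_self f hf
  have h' := mul_inv_self f⁻¹ (by rw [inv_nil]; exact inv_ne_zero hf)
  have : f = f⁻¹⁻¹ := by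
    calc f = f * (f⁻¹ * f⁻¹⁻¹) := by rw [h', mul_one]
      _ = f⁻¹⁻¹ := by rw [← mul_assoc, h, one_mul]
  rwa [← this] at h'

/-- The linear series with coefficients `c`. -/
def letters (c : ι → ℂ) : NCSeries ι
  | [a] => c a
  | _ => 0

theorem letters_nil (c : ι → ℂ) : letters c [] = 0 := rfl
theorem letters_singleton (c : ι → ℂ) (a : ι) : letters c [a] = c a := rfl

theorem tail_letters (c : ι → ℂ) (a : ι) (v : List ι) :
    tail a (letters c) v = c a * (1 : NCSeries ι) v := by
  cases v <;> simp [tail, letters, one_nil, one_cons]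

theorem letters_mul_nil (c : ι → ℂ) (f : NCSeries ι) : (letters c * f) [] = 0 := by
  simp [mul_nil, letters_nil]

/-- Left multiplication by a linear series strips the first letter. This is the coefficient form of
the right-hand side of dF = (∑ g_a x_a) F. -/
theorem letters_mul_cons (c : ι → ℂ) (f : NCSeries ι) (a : ι) (v : List ι) :
    (letters c * f) (a :: v) = c a * f v := by
  rw [mul_cons, letters_nil, zero_mul, zero_add]
  calc (tail a (letters c) * f) v = c a * (1 * f) v := by
        simp only [mul_apply, tail_letters, Finset.mul_sum, mul_assoc]
    _ = c a * f v := by rw [one_mul]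

theorem mul_letters_nil (c : ι → ℂ) (f : NCSeries ι) : (f * letters c) [] = 0 := by
  simp [mul_nil, letters_nil]

theorem mul_letters_append (c : ι → ℂ) (f : NCSeries ι) (a : ι) (v : List ι) :
    (f * letters c) (v ++ [a]) = f v * c a := by
  induction v generalizing f with
  | nil => simp [mul_cons, mul_nil, letters_nil, letters_singleton]
  | cons b v ih =>
    rw [List.cons_append, mul_cons, ih]
    cases v <;> simp [letters, tail]

theorem mul_letters_of_ne_nil (c : ι → ℂ) (f : NCSeries ι) {v : List ι} (hv : v ≠ []) :
    (f * letters c) v = f v.dropLast * c (v.getLast hv) := by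
  conv_lhs => rw [← List.dropLast_append_getLast hv, mul_letters_append]

end NCSeries

variable {ι : Type*}

/-! ### Group-like series -/

namespace NCSeries

/-- The linear extension of a series to generalized words. -/
def pair (f : NCSeries ι) (p : List ι →₀ ℂ) : ℂ := p.sum fun u c => c * f u

theorem pair_add (f : NCSeries ι) (p q : List ι →₀ ℂ) : pair f (p + q) = pair f p + pair f q :=
  Finsupp.sum_add_index' (by simp) (by intros; ring)

theorem pair_single (f : NCSeries ι) (v : List ι) (c : ℂ) :
    pair f (Finsupp.single v c) = c * f v :=
  Finsupp.sum_single_index (by simp)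

theorem pair_smul (f : NCSeries ι) (c : ℂ) (p : List ι →₀ ℂ) :
    pair f (c • p) = c * pair f p := by
  rw [pair, Finsupp.sum_smul_index' (by simp), pair, Finsupp.mul_sum]
  simp [mul_assoc]

theorem pair_add_left (f g : NCSeries ι) (p : List ι →₀ ℂ) :
    pair (f + g) p = pair f p + pair g p := by
  simp only [pair, ← Finsupp.sum_add, add_apply, mul_add]

theorem pair_zero_left (p : List ι →₀ ℂ) : pair 0 p = 0 := by
  simp [pair, zero_apply]

theorem pair_sum {κ M : Type*} [Zero M] (f : NCSeries ι) (D : κ →₀ M) (h : κ → M → List ι →₀ ℂ) :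
    pair f (D.sum h) = D.sum fun i q => pair f (h i q) := by
  let φ : (List ι →₀ ℂ) →+ ℂ :=
    { toFun := pair f
      map_zero' := by simp [pair]
      map_add' := pair_add f }
  exact map_finsuppSum φ D h

theorem pair_mapDomain_cons (f : NCSeries ι) (a : ι) (p : List ι →₀ ℂ) :
    pair f (p.mapDomain (List.cons a)) = pair (tail a f) p :=
  Finsupp.sum_mapDomain_index (by simp) (by intros; ring)

/-- The failure of the shuffle relation of the words `u` and `v`. -/
def defect (f : NCSeries ι) (u v : List ι) : ℂ := f u * f v - pair f (shuffle u v)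

theorem defect_nil_left (f : NCSeries ι) (h : f [] = 1) (v : List ι) : defect f [] v = 0 := by
  simp [defect, shuffle, pair_single, h]

theorem defect_nil_right (f : NCSeries ι) (h : f [] = 1) (u : List ι) : defect f u [] = 0 := by
  simp [defect, shuffle_nil_right, pair_single, h]

theorem defect_one (u v : List ι) : defect (1 : NCSeries ι) u v = 0 := by
  cases u with
  | nil => exact defect_nil_left _ one_nil v
  | cons a u =>
    cases v with
    | nil => exact defect_nil_right _ one_nil _
    | cons b v =>
      have h : ∀ c : ι, tail c (1 : NCSeries ι) = 0 := fun c => ext fun v => one_cons c v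
      simp only [defect, shuffle, pair_add, pair_mapDomain_cons, one_cons, h, pair_zero_left]
      simp

/-- Series that satisfy the shuffle relations. -/
def IsGroupLike (f : NCSeries ι) : Prop := f [] = 1 ∧ ∀ u v, defect f u v = 0

theorem IsGroupLike.mul_eq {f : NCSeries ι} (hf : IsGroupLike f) (u v : List ι) :
    f u * f v = pair f (shuffle u v) := sub_eq_zero.1 (hf.2 u v)

/-- The extra letter can be inserted in n + 1 places, always with the same result. -/
theorem shuffle_singleton_replicate (k : ι) (n : ℕ) :
    shuffle [k] (List.replicate n k) =
      Finsupp.single (List.replicate (n + 1) k) ((n : ℂ) + 1) := by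
  induction n with
  | zero => simp [shuffle]
  | succ n ih =>
    rw [List.replicate_succ, shuffle, ih, shuffle, Finsupp.mapDomain_single,
      Finsupp.mapDomain_single, ← List.replicate_succ, ← List.replicate_succ,
      ← Finsupp.single_add]
    push_cast
    congr 1; ring

theorem IsGroupLike.replicate {f : NCSeries ι} (hf : IsGroupLike f) (k : ι) (n : ℕ) :
    f (List.replicate n k) = f [k] ^ n / (n.factorial : ℂ) := by
  induction n with
  | zero => simpa using hf.1
  | succ n ih =>
    have h := hf.mul_eq [k] (List.replicate n k)
    rw [shuffle_singleton_replicate, pair_single, ih] at h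
    have hn : (n : ℂ) + 1 ≠ 0 := by exact_mod_cast n.succ_ne_zero
    have hn' : (n.factorial : ℂ) ≠ 0 := by exact_mod_cast n.factorial_ne_zero
    rw [Nat.factorial_succ]
    push_cast
    field_simp at h ⊢
    rw [← h]; ring

/-- A group-like series is determined by its coefficients at `k` and at the words that do not end
in `k`. -/
theorem IsGroupLike.shuffleDecomp_sum {f : NCSeries ι} (hf : IsGroupLike f) (k : ι)
    (v : List ι) :
    ((shuffleDecomp k v).sum fun i q => f [k] ^ i / (i.factorial : ℂ) * pair f q) = f v := by
  -- For group-like `f`, `pair f` turns shuffles into products, so it can be applied to the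
  -- decomposition of `v` term by term; k^i contributes f(k)^i / i!.
  have h := congrArg (pair f) (isShuffleDecomp_shuffleDecomp k v).2
  rw [pair_single, one_mul, pair_sum] at h
  rw [h]
  refine Finsupp.sum_congr fun i _ => ?_
  rw [shuffleWord, pair_sum, ← hf.replicate, pair, Finsupp.mul_sum]
  refine Finsupp.sum_congr fun u _ => ?_
  rw [pair_smul, ← hf.mul_eq]; ring

/-! ### Exponential series -/

open Classical in
/-- The series `exp (z x_k)`. -/
def expSeries (k : ι) (z : ℂ) : NCSeries ι := fun v =>
  if ∀ a ∈ v, a = k then z ^ v.length / (v.length.factorial : ℂ) else 0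

theorem expSeries_nil (k : ι) (z : ℂ) : expSeries k z [] = 1 := by simp [expSeries]

theorem expSeries_zero (k : ι) : expSeries k 0 = 1 := by
  ext v
  cases v <;> simp [expSeries, one_nil, one_cons]

theorem expSeries_replicate (k : ι) (z : ℂ) (n : ℕ) :
    expSeries k z (List.replicate n k) = z ^ n / (n.factorial : ℂ) := by
  rw [expSeries, if_pos (fun a h => List.eq_of_mem_replicate h), List.length_replicate]

theorem expSeries_singleton (k : ι) (z : ℂ) : expSeries k z [k] = z := by
  simpa using expSeries_replicate k z 1

/-- The exponential involves only powers of x_k, and the only such power not ending in k is the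
empty word. This is why words not ending in k need no counterterm. -/
theorem expSeries_apply_of_not_suffix {k : ι} {v : List ι} (h : ¬ [k] <:+ v) (z : ℂ) :
    expSeries k z v = (1 : NCSeries ι) v := by
  rcases List.eq_nil_or_concat v with rfl | ⟨u, a, rfl⟩
  · exact expSeries_nil k z
  · rw [one_of_ne (by simp), expSeries, if_neg]
    intro h'
    have : a = k := h' a (by simp)
    subst this
    exact h (by simp)

theorem expSeries_add (k : ι) (z y : ℂ) :
    expSeries k z * expSeries k y = expSeries k (z + y) := by
  ext v
  rw [mul_apply]
  by_cases h : ∀ a ∈ v, a = k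
  -- On a power of k the Cauchy product is the binomial formula; for any other word, one factor of
  -- each splitting contains a foreign letter.
  · have hv : v = List.replicate v.length k := List.eq_replicate_iff.2 ⟨rfl, h⟩
    generalize v.length = N at hv
    subst hv
    rw [expSeries_replicate, add_pow, Finset.sum_div]
    refine Finset.sum_congr rfl fun n hn => ?_
    rw [Finset.mem_range] at hn
    rw [List.take_replicate, List.drop_replicate, expSeries_replicate, expSeries_replicate,
      min_eq_left (by omega), Nat.choose_eq_factorial_div_factorial (by omega),
      Nat.cast_div (Nat.factorial_mul_factorial_dvd_factorial (by omega))]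
    · have h1 : (n.factorial : ℂ) ≠ 0 := by exact_mod_cast n.factorial_ne_zero
      have h2 : ((N - n).factorial : ℂ) ≠ 0 := by exact_mod_cast (N - n).factorial_ne_zero
      have h3 : (N.factorial : ℂ) ≠ 0 := by exact_mod_cast N.factorial_ne_zero
      push_cast
      field_simp
    · push_cast
      exact mul_ne_zero (by exact_mod_cast n.factorial_ne_zero)
        (by exact_mod_cast (N - n).factorial_ne_zero)
  · rw [expSeries, if_neg h]
    refine Finset.sum_eq_zero fun n _ => ?_
    by_cases h1 : ∀ a ∈ v.take n, a = k
    · rw [expSeries, expSeries, if_neg (c := ∀ a ∈ v.drop n, a = k), mul_zero]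
      intro h2
      refine h fun a ha => ?_
      rw [← List.take_append_drop n v, List.mem_append] at ha
      exact ha.elim (h1 a) (h2 a)
    · rw [expSeries, if_neg h1, zero_mul]

theorem expSeries_mul_neg (k : ι) (z : ℂ) : expSeries k z * expSeries k (-z) = 1 := by
  rw [expSeries_add, add_neg_cancel, expSeries_zero]

theorem expSeries_neg_mul (k : ι) (z : ℂ) : expSeries k (-z) * expSeries k z = 1 := by
  rw [expSeries_add, neg_add_cancel, expSeries_zero]

open Classical in
/-- The series `x_k`. -/
def letter (k : ι) : NCSeries ι := letters fun a => if a = k then 1 else 0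

-- The factor x_k stands on the left so that, in the derivative of H exp(ρ log u · x_k), it meets
-- the term H x_k of the equation for H.
open Classical in
theorem hasDerivAt_expSeries (k : ι) (v : List ι) (z : ℂ) :
    HasDerivAt (fun z => expSeries k z v) ((letter k * expSeries k z) v) z := by
  cases v with
  | nil => simpa only [expSeries_nil, letter, letters_mul_nil] using hasDerivAt_const z (1 : ℂ)
  | cons a v =>
    rw [letter, letters_mul_cons]
    by_cases h : ∀ b ∈ a :: v, b = k
    · have ha : a = k := h a (by simp)
      have hv : ∀ b ∈ v, b = k := fun b hb => h b (by simp [hb])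
      simp only [expSeries, if_pos h, if_pos hv, if_pos ha, List.length_cons, one_mul]
      refine ((hasDerivAt_pow (v.length + 1) z).div_const _).congr_deriv ?_
      rw [Nat.factorial_succ]
      have h1 : ((v.length + 1 : ℕ) : ℂ) ≠ 0 := by exact_mod_cast v.length.succ_ne_zero
      push_cast at h1 ⊢
      rw [mul_div_mul_left _ _ h1]
    · have h2 : (if a = k then (1 : ℂ) else 0) * expSeries k z v = 0 := by
        by_cases ha : a = k
        · rw [expSeries, if_neg (c := ∀ b ∈ v, b = k), mul_zero]
          intro hv
          exact h (by simpa [ha] using hv)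
        · simp [ha]
      rw [h2]
      simpa only [expSeries, if_neg h] using hasDerivAt_const z (0 : ℂ)

end NCSeries

open NCSeries

/-! ### Solutions of the differential equation of iterated integrals -/

/-- The exceptional set is needed because a concatenated path may have a corner. -/
theorem eq_of_hasDerivAt_zero {A N : Set ℝ} (hA : A.OrdConnected) (hN : N.Countable)
    {f : ℝ → ℂ} (hf : ContinuousOn f A) (hd : ∀ t ∈ interior A \ N, HasDerivAt f 0 t)
    {s t : ℝ} (hs : s ∈ A) (ht : t ∈ A) : f s = f t := by
  have h := MeasureTheory.integral_eq_of_hasDerivAt_off_countable f (fun _ => 0) (a := s) (b := t)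
    hN (hf.mono (hA.uIcc_subset hs ht)) ?_ (by simp)
  · simp only [intervalIntegral.integral_zero] at h
    exact (sub_eq_zero.1 h.symm).symm
  · intro x hx
    refine hd x ⟨?_, hx.2⟩
    exact interior_mono (hA.uIcc_subset hs ht) (by rw [uIcc, interior_Icc]; exact hx.1)

/-- `F` is a solution of `dF = (∑ g_a x_a) F dt` on `A`, outside of the exceptional set `N`, with
constant term `1`. -/
structure IsSolution (g : ι → ℝ → ℂ) (A N : Set ℝ) (F : ℝ → NCSeries ι) : Prop where
  nil : ∀ t ∈ A, F t [] = 1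
  continuousOn : ∀ v, ContinuousOn (fun t => F t v) A
  hasDerivAt : ∀ t ∈ interior A \ N, ∀ a v,
    HasDerivAt (fun t => F t (a :: v)) (g a t * F t v) t

namespace IsSolution

variable {g : ι → ℝ → ℂ} {A N : Set ℝ} {F F' : ℝ → NCSeries ι}

theorem mono {B : Set ℝ} (h : IsSolution g A N F) (hB : B ⊆ A) : IsSolution g B N F where
  nil t ht := h.nil t (hB ht)
  continuousOn v := (h.continuousOn v).mono hB
  hasDerivAt t ht := h.hasDerivAt t ⟨interior_mono hB ht.1, ht.2⟩

theorem congr_coeff {g' : ι → ℝ → ℂ} (h : IsSolution g A N F)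
    (hg : ∀ a, ∀ t ∈ interior A \ N, g a t = g' a t) : IsSolution g' A N F where
  nil := h.nil
  continuousOn := h.continuousOn
  hasDerivAt t ht a v := hg a t ht ▸ h.hasDerivAt t ht a v

theorem mul_const (h : IsSolution g A N F) (C : NCSeries ι) (hC : C [] = 1) :
    IsSolution g A N (fun t => F t * C) where
  nil t ht := by rw [mul_nil, h.nil t ht, hC, one_mul]
  continuousOn v := by
    simp only [NCSeries.mul_apply]
    exact continuousOn_finsetSum _ fun n _ => (h.continuousOn _).mul continuousOn_const
  hasDerivAt t ht a v := by
    -- The constant term of `F` is 1 near `t`, so the first summand of `mul_cons` does not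
    -- contribute to the derivative.
    have h0 : (fun t => F t []) =ᶠ[𝓝 t] fun _ => 1 := by
      filter_upwards [mem_interior_iff_mem_nhds.1 ht.1] with x hx using h.nil x hx
    have e : (fun t => (F t * C) (a :: v)) =ᶠ[𝓝 t] fun t => C (a :: v) +
        ∑ n ∈ Finset.range (v.length + 1), F t (a :: v.take n) * C (v.drop n) := by
      filter_upwards [h0] with x hx
      rw [mul_cons, hx, one_mul]
      rfl
    refine HasDerivAt.congr_of_eventuallyEq ?_ e
    refine ((HasDerivAt.fun_sum fun n _ =>
      (h.hasDerivAt t ht a (v.take n)).mul_const (C (v.drop n))).const_add _).congr_deriv ?_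
    rw [NCSeries.mul_apply, Finset.mul_sum]
    exact Finset.sum_congr rfl fun _ _ => mul_assoc _ _ _

/-- The derivative at the word a :: v involves only v. By induction the difference of two solutions
therefore has derivative zero. -/
theorem eqOn (h : IsSolution g A N F) (h' : IsSolution g A N F') (hA : A.OrdConnected)
    (hN : N.Countable) {s : ℝ} (hs : s ∈ A) (hss : F s = F' s) {t : ℝ} (ht : t ∈ A) :
    F t = F' t := by
  ext v
  induction v generalizing t with
  | nil => rw [h.nil t ht, h'.nil t ht]
  | cons a v ih =>
    have := eq_of_hasDerivAt_zero hA hN (f := fun t => F t (a :: v) - F' t (a :: v))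
      ((h.continuousOn _).sub (h'.continuousOn _)) (fun x hx => ?_) hs ht
    · simp only [hss, sub_self] at this
      exact (sub_eq_zero.1 this.symm)
    · refine ((h.hasDerivAt x hx a v).sub (h'.hasDerivAt x hx a v)).congr_deriv ?_
      rw [ih (interior_subset hx.1), sub_self]

theorem continuousOn_pair (h : IsSolution g A N F) (p : List ι →₀ ℂ) :
    ContinuousOn (fun t => pair (F t) p) A :=
  continuousOn_finsetSum _ fun u _ => continuousOn_const.mul (h.continuousOn u)

theorem hasDerivAt_pair_cons (h : IsSolution g A N F) {t : ℝ} (ht : t ∈ interior A \ N)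
    (a : ι) (p : List ι →₀ ℂ) :
    HasDerivAt (fun t => pair (F t) (p.mapDomain (List.cons a))) (g a t * pair (F t) p) t := by
  simp only [pair_mapDomain_cons]
  unfold pair
  refine (HasDerivAt.fun_sum fun u _ =>
    (h.hasDerivAt t ht a u).const_mul (p u)).congr_deriv ?_
  rw [Finsupp.mul_sum]
  exact Finset.sum_congr rfl fun _ _ => by ring

/-- The Leibniz rule and the recursion of the shuffle product peel off the same first letters. -/
theorem hasDerivAt_defect (h : IsSolution g A N F) {t : ℝ} (ht : t ∈ interior A \ N)
    (a b : ι) (u v : List ι) :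
    HasDerivAt (fun t => defect (F t) (a :: u) (b :: v))
      (g a t * defect (F t) u (b :: v) + g b t * defect (F t) (a :: u) v) t := by
  simp only [defect, shuffle, pair_add]
  refine (((h.hasDerivAt t ht a u).fun_mul (h.hasDerivAt t ht b v)).fun_sub
    ((h.hasDerivAt_pair_cons ht a _).fun_add (h.hasDerivAt_pair_cons ht b _))).congr_deriv ?_
  ring

/-- By induction on the total length every defect has derivative zero, so it equals its limit along
`l`. The filter may approach a boundary point at which the solution itself diverges. -/
theorem isGroupLike (h : IsSolution g A N F) (hA : A.OrdConnected) (hN : N.Countable)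
    {l : Filter ℝ} [l.NeBot] (hl : ∀ᶠ t in l, t ∈ A)
    (hlim : ∀ u v, Tendsto (fun t => defect (F t) u v) l (𝓝 0)) {t : ℝ} (ht : t ∈ A) :
    IsGroupLike (F t) := by
  refine ⟨h.nil t ht, ?_⟩
  suffices H : ∀ n : ℕ, ∀ u v : List ι, u.length + v.length ≤ n → ∀ t ∈ A,
      defect (F t) u v = 0 from fun u v => H _ u v le_rfl t ht
  intro n
  induction n with
  | zero =>
    intro u v huv t ht
    obtain rfl : u = [] := List.length_eq_zero_iff.1 (by omega)
    exact defect_nil_left _ (h.nil t ht) v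
  | succ n ih =>
    intro u v huv t ht
    cases u with
    | nil => exact defect_nil_left _ (h.nil t ht) v
    | cons a u =>
      cases v with
      | nil => exact defect_nil_right _ (h.nil t ht) _
      | cons b v =>
        simp only [List.length_cons] at huv
        have hc : ∀ s ∈ A, defect (F s) (a :: u) (b :: v) = defect (F t) (a :: u) (b :: v) := by
          intro s hs
          refine eq_of_hasDerivAt_zero hA hN (f := fun t => defect (F t) (a :: u) (b :: v))
            (((h.continuousOn _).mul (h.continuousOn _)).sub (h.continuousOn_pair _))
            (fun x hx => ?_) hs ht
          refine (h.hasDerivAt_defect hx a b u v).congr_deriv ?_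
          rw [ih u (b :: v) (by simp; omega) x (interior_subset hx.1),
            ih (a :: u) v (by simp; omega) x (interior_subset hx.1)]
          ring
        exact tendsto_nhds_unique (tendsto_const_nhds.congr'
          (hl.mono fun s hs => (hc s hs).symm)) (hlim (a :: u) (b :: v))

end IsSolution

/-- t ↦ exp(t z x_k) solves an equation with constant coefficients and is 1 at t = 0, where all
defects vanish. -/
theorem isGroupLike_expSeries (k : ι) (z : ℂ) : IsGroupLike (expSeries k z) := by
  classical
  have h : IsSolution (fun a _ => if a = k then z else 0) univ ∅
      (fun t : ℝ => expSeries k (t * z)) := by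
    have hd : ∀ (t : ℝ) (v : List ι), HasDerivAt (fun t : ℝ => expSeries k (t * z) v)
        ((letter k * expSeries k (t * z)) v * z) t := by
      intro t v
      have h1 : HasDerivAt (fun t : ℝ => (t : ℂ) * z) z t := by
        simpa using (Complex.ofRealCLM.hasDerivAt (x := t)).mul_const z
      exact (hasDerivAt_expSeries k v (t * z)).comp t h1
    refine ⟨fun t _ => expSeries_nil _ _, fun v => ?_, fun t _ a v => ?_⟩
    · exact fun t _ => (hd t v).continuousAt.continuousWithinAt
    · refine (hd t (a :: v)).congr_deriv ?_
      rw [letter, letters_mul_cons]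
      split_ifs <;> ring
  have := h.isGroupLike ordConnected_univ countable_empty (l := pure (0 : ℝ)) (by simp)
    (fun u v => ?_) (mem_univ 1)
  · simpa using this
  · rw [show (0 : ℂ) = defect (expSeries k (((0 : ℝ) : ℂ) * z)) u v by
      simp [expSeries_zero, defect_one]]
    exact tendsto_pure_nhds _ _

/-! ### Iterated integrals of functions -/

/-- The iterated integrals of the functions `g a`, with the first letter integrated last. -/
def iterIntegral (g : ι → ℝ → ℂ) (s : ℝ) : List ι → ℝ → ℂ
  | [], _ => 1
  | a :: v, t => ∫ x in s..t, g a x * iterIntegral g s v x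

/-- The generating series of the iterated integrals from `s` to `t`. -/
def transport (g : ι → ℝ → ℂ) (s t : ℝ) : NCSeries ι := fun v => iterIntegral g s v t

theorem transport_nil (g : ι → ℝ → ℂ) (s t : ℝ) : transport g s t [] = 1 := rfl

theorem transport_cons (g : ι → ℝ → ℂ) (s t : ℝ) (a : ι) (v : List ι) :
    transport g s t (a :: v) = ∫ x in s..t, g a x * transport g s x v := rfl

theorem transport_self (g : ι → ℝ → ℂ) (s : ℝ) : transport g s s = 1 := by
  ext v
  cases v with
  | nil => rfl
  | cons a v => simp [transport_cons, one_cons]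

/-- Coefficients for which the differential equation of iterated integrals can be solved on the
interval `A`. -/
structure IsRegularCoeff (g : ι → ℝ → ℂ) (A N : Set ℝ) : Prop where
  ordConnected : A.OrdConnected
  countable : N.Countable
  continuousAt : ∀ a, ∀ t ∈ interior A \ N, ContinuousAt (g a) t
  intervalIntegrable : ∀ a, ∀ s ∈ A, ∀ t ∈ A, IntervalIntegrable (g a) MeasureTheory.volume s t

/-- The intervals in use are open, half-open or closed; this reduces statements about primitives on
them to compact intervals. -/
theorem exists_Icc_mem_nhdsWithin {A : Set ℝ} {s t : ℝ}
    (hs : s ∈ A) (ht : t ∈ A) :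
    ∃ p ∈ A, ∃ q ∈ A, s ∈ Icc p q ∧ t ∈ Icc p q ∧ Icc p q ∈ 𝓝[A] t := by
  obtain ⟨p, hp, hps, hpt, hp'⟩ : ∃ p ∈ A, p ≤ s ∧ p ≤ t ∧ Ici p ∈ 𝓝[A] t := by
    by_cases h : ∃ p ∈ A, p < t
    · obtain ⟨p, hp, hpt⟩ := h
      refine ⟨min p s, by rcases min_choice p s with h | h <;> rw [h] <;> assumption,
        min_le_right _ _, (min_le_left _ _).trans hpt.le, ?_⟩
      exact mem_nhdsWithin_of_mem_nhds (Ici_mem_nhds ((min_le_left _ _).trans_lt hpt))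
    · push Not at h
      -- Here `t` is the least element of `A` and serves as left end point itself.
      exact ⟨t, ht, h s hs, le_rfl, mem_of_superset self_mem_nhdsWithin h⟩
  obtain ⟨q, hq, hqs, hqt, hq'⟩ : ∃ q ∈ A, s ≤ q ∧ t ≤ q ∧ Iic q ∈ 𝓝[A] t := by
    by_cases h : ∃ q ∈ A, t < q
    · obtain ⟨q, hq, hqt⟩ := h
      refine ⟨max q s, by rcases max_choice q s with h | h <;> rw [h] <;> assumption,
        le_max_right _ _, hqt.le.trans (le_max_left _ _), ?_⟩
      exact mem_nhdsWithin_of_mem_nhds (Iic_mem_nhds (hqt.trans_le (le_max_left _ _)))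
    · push Not at h
      exact ⟨t, ht, h s hs, le_rfl, mem_of_superset self_mem_nhdsWithin h⟩
  exact ⟨p, hp, q, hq, ⟨hps, hqs⟩, ⟨hpt, hqt⟩, inter_mem hp' hq'⟩

namespace IsRegularCoeff

variable {g : ι → ℝ → ℂ} {A N : Set ℝ}

theorem intervalIntegrable_mul (hg : IsRegularCoeff g A N) {f : ℝ → ℂ} (hf : ContinuousOn f A)
    (a : ι) {s t : ℝ} (hs : s ∈ A) (ht : t ∈ A) :
    IntervalIntegrable (fun x => g a x * f x) MeasureTheory.volume s t :=
  (hg.intervalIntegrable a s hs t ht).mul_continuousOn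
    (hf.mono (hg.ordConnected.uIcc_subset hs ht))

theorem continuousOn_integral (hg : IsRegularCoeff g A N) {f : ℝ → ℂ} (hf : ContinuousOn f A)
    (a : ι) {s : ℝ} (hs : s ∈ A) : ContinuousOn (fun t => ∫ x in s..t, g a x * f x) A := by
  intro t ht
  obtain ⟨p, hp, q, hq, hsI, htI, hI⟩ := exists_Icc_mem_nhdsWithin hs ht
  have hpq : p ≤ q := hsI.1.trans hsI.2
  have := intervalIntegral.continuousOn_primitive_interval'
    (hg.intervalIntegrable_mul hf a hp hq) (a := s) (by rwa [uIcc_of_le hpq])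
  rw [uIcc_of_le hpq] at this
  exact (this t htI).mono_of_mem_nhdsWithin hI

theorem hasDerivAt_integral (hg : IsRegularCoeff g A N) {f : ℝ → ℂ} (hf : ContinuousOn f A)
    (a : ι) {s t : ℝ} (hs : s ∈ A) (ht : t ∈ interior A \ N) :
    HasDerivAt (fun t => ∫ x in s..t, g a x * f x) (g a t * f t) t := by
  have hA : A ∈ 𝓝 t := mem_interior_iff_mem_nhds.1 ht.1
  obtain ⟨p, hp, q, hq, hsI, htI, hI⟩ :=
    exists_Icc_mem_nhdsWithin hs (interior_subset ht.1)
  rw [nhdsWithin_eq_nhds.2 hA] at hI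
  have hpq : p ≤ q := hsI.1.trans hsI.2
  refine intervalIntegral.integral_hasDerivAt_right
    (hg.intervalIntegrable_mul hf a hs (interior_subset ht.1)) ?_
    ((hg.continuousAt a t ht).mul (hf.continuousAt hA))
  refine ⟨Icc p q, hI, ?_⟩
  rw [MeasureTheory.Measure.restrict_congr_set MeasureTheory.Ioc_ae_eq_Icc.symm]
  exact ((intervalIntegrable_iff_integrableOn_Ioc_of_le hpq).1
    (hg.intervalIntegrable_mul hf a hp hq)).aestronglyMeasurable

theorem isSolution_transport (hg : IsRegularCoeff g A N) {s : ℝ} (hs : s ∈ A) :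
    IsSolution g A N (transport g s) := by
  have hc : ∀ v, ContinuousOn (fun t => transport g s t v) A := by
    intro v
    induction v with
    | nil => exact continuousOn_const
    | cons a v ih => exact hg.continuousOn_integral ih a hs
  exact ⟨fun t _ => rfl, hc, fun t ht a v => hg.hasDerivAt_integral (hc v) a hs ht⟩

/-- Both sides solve the equation and agree at `s`. Read backwards, the iterated integrals from `s`
to `t` are F(t) F(s)⁻¹ for any solution F. -/
theorem eq_transport_mul (hg : IsRegularCoeff g A N) {F : ℝ → NCSeries ι}
    (hF : IsSolution g A N F) {s t : ℝ} (hs : s ∈ A) (ht : t ∈ A) :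
    F t = transport g s t * F s :=
  hF.eqOn ((hg.isSolution_transport hs).mul_const (F s) (hF.nil s hs)) hg.ordConnected
    hg.countable hs (by rw [transport_self, one_mul]) ht

end IsRegularCoeff

/-! ### Negligible series -/

theorem NCSeries.expSeries_mul_apply (k : ι) (ρ z : ℂ) (v : List ι) :
    expSeries k (ρ * z) v = expSeries k ρ v * z ^ v.length := by
  rw [expSeries, expSeries]
  split_ifs <;> ring

section Negligible

variable {τ : Type*} {l : Filter τ} {ℓ : τ → ℂ}

/-- The coefficients of `f` tend to zero, even after multiplication by powers of `ℓ`. -/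
def Negligible (l : Filter τ) (ℓ : τ → ℂ) (f : τ → NCSeries ι) : Prop :=
  ∀ v n, Tendsto (fun t => ℓ t ^ n * f t v) l (𝓝 0)

namespace Negligible

variable {f : τ → NCSeries ι}

theorem tendsto (hf : Negligible l ℓ f) (v : List ι) : Tendsto (fun t => f t v) l (𝓝 0) := by
  simpa using hf v 0

/-- Coefficients of exp(ρ ℓ x_k) are constants times powers of ℓ, which the definition of
`Negligible` absorbs. -/
theorem expSeries_mul (hf : Negligible l ℓ f) (k : ι) (ρ : ℂ) :
    Negligible l ℓ fun t => expSeries k (ρ * ℓ t) * f t := by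
  intro v n
  simp only [NCSeries.mul_apply, Finset.mul_sum, expSeries_mul_apply]
  rw [← Finset.sum_const_zero (s := Finset.range (v.length + 1))]
  refine tendsto_finsetSum _ fun m _ => ?_
  have := (hf (v.drop m) (n + (v.take m).length)).const_mul (expSeries k ρ (v.take m))
  rw [mul_zero] at this
  exact this.congr fun t => by ring

theorem mul_expSeries (hf : Negligible l ℓ f) (k : ι) (ρ : ℂ) :
    Negligible l ℓ fun t => f t * expSeries k (ρ * ℓ t) := by
  intro v n
  simp only [NCSeries.mul_apply, Finset.mul_sum, expSeries_mul_apply]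
  rw [← Finset.sum_const_zero (s := Finset.range (v.length + 1))]
  refine tendsto_finsetSum _ fun m _ => ?_
  have := (hf (v.take m) (n + (v.drop m).length)).const_mul (expSeries k ρ (v.drop m))
  rw [mul_zero] at this
  exact this.congr fun t => by ring

theorem inv (hf : Negligible l ℓ fun t => f t - 1) (h1 : ∀ t, f t [] = 1) :
    Negligible l ℓ fun t => (f t)⁻¹ - 1 := by
  intro v
  induction hv : v.length using Nat.strong_induction_on generalizing v with
  | _ N ih =>
    intro n
    cases v with
    | nil => simpa [NCSeries.sub_apply, inv_nil, h1, one_nil] using! tendsto_const_nhds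
    | cons a v =>
      simp only [NCSeries.sub_apply, inv_cons, one_cons, h1, inv_one, sub_zero, neg_mul, one_mul,
        mul_neg, NCSeries.mul_apply, Finset.mul_sum]
      simp only [Finset.sum_neg_distrib]
      rw [← neg_zero, ← Finset.sum_const_zero (s := Finset.range (v.length + 1))]
      refine (tendsto_finsetSum _ fun m _ => ?_).neg
      have h2 := hf (a :: v.take m) n
      simp only [NCSeries.sub_apply, one_cons, sub_zero] at h2
      -- The weight ℓ^n is carried entirely by the factor from `f`; for the shorter word plain
      -- convergence of the inverse suffices.
      have h3 := ih _ (by rw [← hv]; simp) (v.drop m) rfl 0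
      simp only [pow_zero, one_mul] at h3
      have h4 := (h2.mul h3).add (h2.mul_const ((1 : NCSeries ι) (v.drop m)))
      simp only [mul_zero, zero_mul, add_zero] at h4
      refine h4.congr fun t => ?_
      rw [NCSeries.sub_apply, tail]; ring

theorem congr {f' : τ → NCSeries ι} (hf : Negligible l ℓ f) (h : ∀ᶠ t in l, f t = f' t) :
    Negligible l ℓ f' := fun v n =>
  (hf v n).congr' (h.mono fun t ht => by rw [ht])

/-- Conjugation of `f = 1 + o(1)` by `exp (ρ ℓ x_k)`. -/
theorem tendsto_conj (hf : Negligible l ℓ fun t => f t - 1) (k : ι) (ρ : ℂ) (C : NCSeries ι)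
    (v : List ι) :
    Tendsto (fun t => (expSeries k (-ρ * ℓ t) * (f t * expSeries k (ρ * ℓ t) * C)) v) l
      (𝓝 (C v)) := by
  have h := (hf.mul_expSeries k ρ).expSeries_mul k (-ρ)
  -- Writing f = 1 + (f - 1), the part with 1 gives exactly `C`, and the rest stays negligible
  -- between the two exponentials.
  have e : ∀ t, expSeries k (-ρ * ℓ t) * (f t * expSeries k (ρ * ℓ t) * C) =
      expSeries k (-ρ * ℓ t) * ((f t - 1) * expSeries k (ρ * ℓ t)) * C + C := by
    intro t
    have := expSeries_neg_mul k (ρ * ℓ t)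
    rw [← neg_mul] at this
    calc _ = expSeries k (-ρ * ℓ t) * ((f t - 1) * expSeries k (ρ * ℓ t)) * C +
          expSeries k (-ρ * ℓ t) * expSeries k (ρ * ℓ t) * C := by noncomm_ring
      _ = _ := by rw [this, one_mul]
  simp only [e, add_apply]
  have h0 : Tendsto (fun t => (expSeries k (-ρ * ℓ t) * ((f t - 1) * expSeries k (ρ * ℓ t)) * C) v)
      l (𝓝 0) := by
    simp only [NCSeries.mul_apply _ C]
    rw [← Finset.sum_const_zero (s := Finset.range (v.length + 1))]
    refine tendsto_finsetSum _ fun m _ => ?_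
    simpa using (h.tendsto (v.take m)).mul_const (C (v.drop m))
  simpa using h0.add_const (C v)

end Negligible

end Negligible

/-! ### Regularization at a simple pole -/

section Regularize

variable {g : ι → ℝ → ℂ} {T : ℝ} {N : Set ℝ} {F H : ℝ → NCSeries ι} {log : ℝ → ℂ} {k : ι} {ρ : ℂ}

/-- This is F(T) F(t)⁻¹ with F(t)⁻¹ = exp(-ρ log t · x_k) H(t)⁻¹, separated into the divergent
exponential and a negligible remainder. -/
theorem eventually_transport_eq (hT : 0 < T) (hg : IsRegularCoeff g (Ioc 0 T) N)
    (hF : IsSolution g (Ioc 0 T) N F)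
    (hFH : ∀ᶠ t in 𝓝[>] (0 : ℝ), F t = H t * expSeries k (ρ * log t)) (hH : ∀ t, H t [] = 1) :
    ∀ᶠ t in 𝓝[>] (0 : ℝ), transport g t T =
      F T * (expSeries k (-ρ * log t) + expSeries k (-ρ * log t) * ((H t)⁻¹ - 1)) := by
  filter_upwards [hFH, Ioc_mem_nhdsGT hT] with t ht htT
  have h1 := hg.eq_transport_mul hF htT ⟨hT, le_rfl⟩
  have h2 := mul_inv_self (H t) (by rw [hH]; exact one_ne_zero)
  have h3 := expSeries_mul_neg k (ρ * log t)
  rw [← neg_mul] at h3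
  rw [ht] at h1
  calc transport g t T = transport g t T * (H t * (H t)⁻¹) := by rw [h2, mul_one]
    _ = transport g t T * (H t * (expSeries k (ρ * log t) * expSeries k (-ρ * log t)) * (H t)⁻¹) := by
      rw [h3, mul_one]
    _ = transport g t T * (H t * expSeries k (ρ * log t)) * expSeries k (-ρ * log t) * (H t)⁻¹ := by
      noncomm_ring
    _ = _ := by rw [← h1]; noncomm_ring

/-- The right factor is evaluated only at suffixes of `v`. None of them ends in k, so the
exponential contributes as the series 1. -/
theorem tendsto_transport_of_not_suffix (hT : 0 < T) (hg : IsRegularCoeff g (Ioc 0 T) N)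
    (hF : IsSolution g (Ioc 0 T) N F)
    (hFH : ∀ᶠ t in 𝓝[>] (0 : ℝ), F t = H t * expSeries k (ρ * log t)) (hH : ∀ t, H t [] = 1)
    (hN : Negligible (𝓝[>] (0 : ℝ)) log fun t => H t - 1) {v : List ι} (hv : ¬ [k] <:+ v) :
    Tendsto (fun t => transport g t T v) (𝓝[>] (0 : ℝ)) (𝓝 (F T v)) := by
  have hK := (hN.inv hH).expSeries_mul k (-ρ)
  have : Tendsto (fun t => (F T * (expSeries k (-ρ * log t) +
      expSeries k (-ρ * log t) * ((H t)⁻¹ - 1))) v) (𝓝[>] (0 : ℝ)) (𝓝 ((F T * 1) v)) := by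
    simp only [NCSeries.mul_apply (F T)]
    refine tendsto_finsetSum _ fun m _ => Tendsto.const_mul _ ?_
    have hm : ¬ [k] <:+ v.drop m := fun h => hv (h.trans (List.drop_suffix m v))
    simp only [add_apply, expSeries_apply_of_not_suffix hm]
    simpa using (hK.tendsto (v.drop m)).const_add ((1 : NCSeries ι) (v.drop m))
  rw [mul_one] at this
  exact this.congr' ((eventually_transport_eq hT hg hF hFH hH).mono fun t ht => by simp only [ht])

/-- At the word k the exponential contributes exactly -ρ log t, which the counterterm cancels. -/
theorem tendsto_transport_singleton (hT : 0 < T) (hg : IsRegularCoeff g (Ioc 0 T) N)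
    (hF : IsSolution g (Ioc 0 T) N F)
    (hFH : ∀ᶠ t in 𝓝[>] (0 : ℝ), F t = H t * expSeries k (ρ * log t)) (hH : ∀ t, H t [] = 1)
    (hN : Negligible (𝓝[>] (0 : ℝ)) log fun t => H t - 1) :
    Tendsto (fun t => ρ * log t + transport g t T [k]) (𝓝[>] (0 : ℝ)) (𝓝 (F T [k])) := by
  have hK := ((hN.inv hH).expSeries_mul k (-ρ)).tendsto [k]
  have := hK.const_add (F T [k])
  rw [add_zero] at this
  refine this.congr' ((eventually_transport_eq hT hg hF hFH hH).mono fun t ht => ?_)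
  beta_reduce
  rw [ht, mul_cons (F T), hF.nil T ⟨hT, le_rfl⟩]
  simp only [tail, add_apply, expSeries_nil, expSeries_singleton, mul_nil, NCSeries.sub_apply,
    inv_nil, hH, one_nil]
  ring

/-- Near 0, F is a group-like exponential plus a negligible series. The defect consists of cross
terms and terms in the remainder; the cross terms vanish in the limit although the exponential
diverges, since it grows only like powers of log. -/
theorem isGroupLike_of_asymptotics (hT : 0 < T) (hg : IsRegularCoeff g (Ioc 0 T) N)
    (hF : IsSolution g (Ioc 0 T) N F)
    (hFH : ∀ᶠ t in 𝓝[>] (0 : ℝ), F t = H t * expSeries k (ρ * log t))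
    (hN : Negligible (𝓝[>] (0 : ℝ)) log fun t => H t - 1) :
    IsGroupLike (F T) := by
  have hM := hN.mul_expSeries k ρ
  set M : ℝ → NCSeries ι := fun t => (H t - 1) * expSeries k (ρ * log t) with hMdef
  have hFM : ∀ᶠ t in 𝓝[>] (0 : ℝ), F t = expSeries k (ρ * log t) + M t := by
    filter_upwards [hFH] with t ht
    rw [ht, hMdef]; noncomm_ring
  refine hF.isGroupLike (l := 𝓝[>] (0 : ℝ)) hg.ordConnected hg.countable (Ioc_mem_nhdsGT hT)
    (fun u v => ?_) ⟨hT, le_rfl⟩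
  have hEM : ∀ u v, Tendsto (fun t => expSeries k (ρ * log t) u * M t v) (𝓝[>] (0 : ℝ)) (𝓝 0) := by
    intro u v
    have := (hM v u.length).const_mul (expSeries k ρ u)
    rw [mul_zero] at this
    refine this.congr fun t => ?_
    rw [expSeries_mul_apply]; ring
  have hp : ∀ p, Tendsto (fun t => pair (M t) p) (𝓝[>] (0 : ℝ)) (𝓝 0) := by
    intro p
    simp only [pair, Finsupp.sum]
    rw [← Finset.sum_const_zero (ι := List ι) (M := ℂ) (s := p.support)]
    exact tendsto_finsetSum _ fun u _ => by simpa using (hM.tendsto u).const_mul (p u)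
  have hlim := ((hEM u v).add (hEM v u)).add
    (((hM.tendsto u).mul (hM.tendsto v)).sub (hp (shuffle u v)))
  simp only [mul_zero, sub_zero, add_zero] at hlim
  refine hlim.congr' (hFM.mono fun t ht => ?_)
  have h0 := (isGroupLike_expSeries k (ρ * log t)).mul_eq u v
  beta_reduce
  rw [ht, defect, pair_add_left, ← h0, add_apply, add_apply]
  ring

end Regularize

/-! ### The local solution at a simple pole -/

open Classical in
/-- The primitive of `q` on the disc of radius `R` that vanishes at the origin. -/
def primitiveOnBall (R : ℝ) (q : ℂ → ℂ) : ℂ → ℂ :=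
  -- The default 0 also vanishes at the origin, so `primitiveOnBall_zero` needs no hypothesis.
  if h : ∃ p : ℂ → ℂ, p 0 = 0 ∧ ∀ z ∈ Metric.ball (0 : ℂ) R, HasDerivAt p (q z) z
  then h.choose else 0

theorem primitiveOnBall_zero (R : ℝ) (q : ℂ → ℂ) : primitiveOnBall R q 0 = 0 := by
  unfold primitiveOnBall
  split_ifs with h
  · exact h.choose_spec.1
  · rfl

theorem hasDerivAt_primitiveOnBall {R : ℝ} {q : ℂ → ℂ}
    (hq : DifferentiableOn ℂ q (Metric.ball 0 R)) {z : ℂ} (hz : z ∈ Metric.ball (0 : ℂ) R) :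
    HasDerivAt (primitiveOnBall R q) (q z) z := by
  have h : ∃ p : ℂ → ℂ, p 0 = 0 ∧ ∀ z ∈ Metric.ball (0 : ℂ) R, HasDerivAt p (q z) z := by
    obtain ⟨p, hp0, hp⟩ := hq.isExactOn_ball.with_val_at 0 0
    exact ⟨p, hp0, hp⟩
  rw [primitiveOnBall, dif_pos h]
  exact h.choose_spec.2 z hz

open Classical in
/-- The coefficients of the solution `H` of `u H' = (∑ h_a x_a) H - ρ H x_k` with `H(0) = 1`. -/
def poleSeries (R : ℝ) (k : ι) (ρ : ℂ) (h : ι → ℂ → ℂ) : List ι → ℂ → ℂ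
  | [] => fun _ => 1
  -- `dslope` at 0 is division by u, legitimate because the bracket vanishes at 0. The test on the
  -- last letter encodes right multiplication by x_k; both recursive calls are on shorter words.
  | a :: v => primitiveOnBall R (dslope (fun u => h a u * poleSeries R k ρ h v u -
      ρ * (poleSeries R k ρ h (a :: v).dropLast u *
        if (a :: v).getLast (List.cons_ne_nil a v) = k then 1 else 0)) 0)
termination_by v => v.length

/-- The generating series of `poleSeries`. -/
def poleSolution (R : ℝ) (k : ι) (ρ : ℂ) (h : ι → ℂ → ℂ) (u : ℂ) : NCSeries ι :=
  fun v => poleSeries R k ρ h v u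

section PoleSeries

variable {R : ℝ} {k : ι} {ρ : ℂ} {h : ι → ℂ → ℂ}

theorem poleSeries_zero {v : List ι} (hv : v ≠ []) : poleSeries R k ρ h v 0 = 0 := by
  cases v with
  | nil => exact absurd rfl hv
  | cons a v => rw [poleSeries, primitiveOnBall_zero]

-- The Fuchsian equation is solved word by word. The right-hand side vanishes at 0, so its quotient
-- by u is holomorphic on the whole disc and has a primitive without a logarithm.
open Classical in
theorem poleSeries_spec (hR : 0 < R) (hh : ∀ a, DifferentiableOn ℂ (h a) (Metric.ball 0 R))
    (h0 : ∀ a, h a 0 = if a = k then ρ else 0) (v : List ι) :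
    DifferentiableOn ℂ (poleSeries R k ρ h v) (Metric.ball 0 R) ∧
    ∀ u ∈ Metric.ball (0 : ℂ) R, u ≠ 0 → HasDerivAt (poleSeries R k ρ h v)
      (u⁻¹ * (letters (fun a => h a u) * poleSolution R k ρ h u -
        ρ • (poleSolution R k ρ h u * letter k)) v) u := by
  induction hn : v.length using Nat.strong_induction_on generalizing v with
  | _ n ih =>
    cases v with
    | nil =>
      have e : poleSeries R k ρ h ([] : List ι) = fun _ => 1 := by rw [poleSeries]
      rw [e]
      refine ⟨differentiableOn_const _, fun u _ _ => ?_⟩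
      rw [NCSeries.sub_apply, smul_apply, letters_mul_nil, letter, mul_letters_nil]
      simpa using hasDerivAt_const u (1 : ℂ)
    | cons a v =>
      set q : ℂ → ℂ := fun u => h a u * poleSeries R k ρ h v u -
        ρ * (poleSeries R k ρ h (a :: v).dropLast u *
          if (a :: v).getLast (List.cons_ne_nil a v) = k then 1 else 0) with hq
      have e : poleSeries R k ρ h (a :: v) = primitiveOnBall R (dslope q 0) := by rw [poleSeries]
      have hqd : DifferentiableOn ℂ q (Metric.ball 0 R) := by
        have h1 := (ih _ (by rw [← hn]; simp) v rfl).1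
        have h2 := (ih _ (by rw [← hn]; simp) (a :: v).dropLast rfl).1
        exact ((hh a).mul h1).sub ((h2.mul_const _).const_mul ρ)
      -- For one letter this is h_a(0) - ρ δ_{ak} = 0, the reason for extracting exp(ρ log u · x_k);
      -- for longer words both lower coefficients vanish at 0.
      have hq0 : q 0 = 0 := by
        rw [hq]
        cases v with
        | nil =>
          simp only [h0, List.dropLast_singleton, List.getLast_singleton, poleSeries]
          by_cases ha : a = k <;> simp [ha]
        | cons b w =>
          simp [poleSeries_zero (List.cons_ne_nil b w), List.dropLast_cons_cons,
            poleSeries_zero (List.cons_ne_nil a _)]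
      have hd : DifferentiableOn ℂ (dslope q 0) (Metric.ball 0 R) :=
        (Complex.differentiableOn_dslope (Metric.ball_mem_nhds 0 hR)).2 hqd
      have hder := fun u (hu : u ∈ Metric.ball (0 : ℂ) R) => hasDerivAt_primitiveOnBall hd hu
      rw [e]
      refine ⟨fun u hu => (hder u hu).differentiableAt.differentiableWithinAt, fun u hu hu0 => ?_⟩
      refine (hder u hu).congr_deriv ?_
      rw [dslope_of_ne _ hu0, slope_def_field, hq0, sub_zero, sub_zero, div_eq_inv_mul,
        NCSeries.sub_apply, smul_apply, letters_mul_cons, letter,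
        mul_letters_of_ne_nil _ _ (List.cons_ne_nil a v)]
      rfl

end PoleSeries

/-- `H` is a holomorphic solution of `u H' = (∑ u f_a x_a) H - ρ H x_k` on the disc of radius `R`
with `H(0) = 1`. -/
structure IsPoleSolution (f : ι → ℂ → ℂ) (k : ι) (ρ : ℂ) (R : ℝ) (H : ℂ → NCSeries ι) : Prop where
  nil : ∀ u, H u [] = 1
  zero : H 0 = 1
  differentiableOn : ∀ v, DifferentiableOn ℂ (fun u => H u v) (Metric.ball 0 R)
  hasDerivAt : ∀ u ∈ Metric.ball (0 : ℂ) R, u ≠ 0 → ∀ v, HasDerivAt (fun u => H u v)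
    (u⁻¹ * (letters (fun a => u * f a u) * H u - ρ • (H u * letter k)) v) u

-- By the removable singularity theorem u f_a(u) extends over the puncture, with value ρ at a = k
-- and 0 otherwise.
open Classical in
theorem exists_isPoleSolution {f : ι → ℂ → ℂ} {k : ι} {ρ : ℂ} {R : ℝ} (hR : 0 < R)
    (hf : ∀ a, DifferentiableOn ℂ (f a) (Metric.ball 0 R \ {0}))
    (hρ : ∀ a, Tendsto (fun u => u * f a u) (𝓝[≠] 0) (𝓝 (if a = k then ρ else 0))) :
    ∃ H, IsPoleSolution f k ρ R H := by
  set h : ι → ℂ → ℂ := fun a => Function.update (fun u => u * f a u) 0 (if a = k then ρ else 0)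
    with hdef
  have h0 : ∀ a, h a 0 = if a = k then ρ else 0 := fun a => by simp [hdef]
  have hne : ∀ a, ∀ u ≠ 0, h a u = u * f a u := fun a u hu => by simp [hdef, hu]
  have hh : ∀ a, DifferentiableOn ℂ (h a) (Metric.ball 0 R) := by
    intro a
    refine (Complex.differentiableOn_compl_singleton_and_continuousAt_iff
      (Metric.ball_mem_nhds (0 : ℂ) hR)).1 ⟨?_, ?_⟩
    · exact (differentiableOn_id.mul (hf a)).congr fun u hu => hne a u hu.2
    · exact continuousAt_update_same.2 (hρ a)
  refine ⟨poleSolution R k ρ h, fun u => by rw [poleSolution, poleSeries], ?_,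
    fun v => (poleSeries_spec hR hh h0 v).1, fun u hu hu0 v => ?_⟩
  · ext v
    by_cases hv : v = []
    · subst hv; rw [poleSolution, poleSeries]; rfl
    · rw [poleSolution, poleSeries_zero hv, one_of_ne hv]
  · have := (poleSeries_spec hR hh h0 v).2 u hu hu0
    simp only [hne _ u hu0] at this
    exact this

/-- By continuity Im(L(x) - L(t)) stays in (-π, π) near t, so L is locally L(t) plus the principal
logarithm of U(x)/U(t). -/
theorem hasDerivAt_log_branch {U L : ℝ → ℂ} {t : ℝ} {U' : ℂ} (hU : HasDerivAt U U' t)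
    (hL : ContinuousAt L t) (he : ∀ᶠ x in 𝓝 t, Complex.exp (L x) = U x) :
    HasDerivAt L (U' / U t) t := by
  have h0 : U t ≠ 0 := he.self_of_nhds ▸ Complex.exp_ne_zero _
  have e : L =ᶠ[𝓝 t] fun x => L t + Complex.log (U x / U t) := by
    have h1 : Tendsto (fun x => (L x - L t).im) (𝓝 t) (𝓝 0) := by
      have := (Complex.continuous_im.tendsto _).comp (hL.sub_const (L t))
      simpa [Function.comp_def] using this
    filter_upwards [he, h1.eventually (Ioo_mem_nhds (neg_lt_zero.2 Real.pi_pos) Real.pi_pos)]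
      with x hx hi
    rw [← hx, ← he.self_of_nhds, ← Complex.exp_sub, Complex.log_exp hi.1 hi.2.le]
    ring
  refine HasDerivAt.congr_of_eventuallyEq ?_ e
  have h2 := ((hU.div_const (U t)).clog_real (by simp [div_self h0])).const_add (L t)
  simpa [div_self h0] using h2

theorem IsPoleSolution.isSolution {f : ι → ℂ → ℂ} {k : ι} {ρ : ℂ} {R : ℝ} {H : ℂ → NCSeries ι}
    (hH : IsPoleSolution f k ρ R H) {A : Set ℝ} {U U' L : ℝ → ℂ} (hU : ContinuousOn U A)
    (hUR : ∀ t ∈ A, U t ∈ Metric.ball (0 : ℂ) R) (hU' : ∀ t ∈ interior A, HasDerivAt U (U' t) t)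
    (hL : ContinuousOn L A) (he : ∀ t ∈ A, Complex.exp (L t) = U t) :
    IsSolution (fun a t => f a (U t) * U' t) A ∅ (fun t => H (U t) * expSeries k (ρ * L t)) where
  nil t _ := by rw [mul_nil, hH.nil, expSeries_nil, one_mul]
  continuousOn v := by
    simp only [NCSeries.mul_apply, expSeries_mul_apply]
    refine continuousOn_finsetSum _ fun n _ => ContinuousOn.mul ?_ ?_
    · exact (hH.differentiableOn _).continuousOn.comp hU hUR
    · exact continuousOn_const.mul (hL.pow _)
  hasDerivAt t ht a v := by
    have ht' := mem_interior_iff_mem_nhds.1 ht.1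
    have htA := interior_subset ht.1
    have h0 : U t ≠ 0 := he t htA ▸ Complex.exp_ne_zero _
    have hL' := hasDerivAt_log_branch (hU' t ht.1) (hL.continuousAt ht')
      (by filter_upwards [ht'] with x hx using he x hx)
    set P : NCSeries ι := letters (fun a => U t * f a (U t)) * H (U t) -
      ρ • (H (U t) * letter k) with hP
    set E : NCSeries ι := expSeries k (ρ * L t) with hE
    have h1 : ∀ v, HasDerivAt (fun t => H (U t) v) (((U' t / U t) • P) v) t := by
      intro v
      refine ((hH.hasDerivAt (U t) (hUR t htA) h0 v).comp t (hU' t ht.1)).congr_deriv ?_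
      rw [smul_apply]; ring
    have h2 : ∀ v, HasDerivAt (fun t => expSeries k (ρ * L t) v)
        (((U' t / U t) • (ρ • (letter k * E))) v) t := by
      intro v
      refine ((hasDerivAt_expSeries k v (ρ * L t)).comp t (hL'.const_mul ρ)).congr_deriv ?_
      rw [smul_apply, smul_apply]; ring
    have h3 : HasDerivAt (fun t => (H (U t) * expSeries k (ρ * L t)) (a :: v))
        ((((U' t / U t) • P) * E + H (U t) * ((U' t / U t) • (ρ • (letter k * E)))) (a :: v)) t := by
      simp only [NCSeries.mul_apply, add_apply, ← Finset.sum_add_distrib]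
      exact HasDerivAt.fun_sum fun n _ => (h1 _).fun_mul (h2 _)
    refine h3.congr_deriv ?_
    -- The terms ρ H x_k E from H' and from the derivative of the exponential cancel.
    have h4 : ((U' t / U t) • P) * E + H (U t) * ((U' t / U t) • (ρ • (letter k * E))) =
        (U' t / U t) • (letters (fun a => U t * f a (U t)) * (H (U t) * E)) := by
      rw [hP]
      simp only [smul_mul_assoc, mul_smul_comm, sub_mul, smul_sub, mul_assoc, sub_add_cancel]
    rw [h4, smul_apply, letters_mul_cons]
    field_simp

/-- Bounded argument enters here: it gives |ℓ| ≤ -Re ℓ + B once Re ℓ ≤ 0, and exponential decay in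
Re ℓ beats powers of that. The shift by B costs only a factor e^B. -/
theorem tendsto_pow_mul_exp {τ : Type*} {l : Filter τ} {ℓ : τ → ℂ} {B : ℝ}
    (h0 : Tendsto (fun t => Complex.exp (ℓ t)) l (𝓝 0)) (hB : ∀ᶠ t in l, |(ℓ t).im| ≤ B) (n : ℕ) :
    Tendsto (fun t => ℓ t ^ n * Complex.exp (ℓ t)) l (𝓝 0) := by
  have hre : Tendsto (fun t => -(ℓ t).re + B) l atTop := by
    refine tendsto_atTop_add_const_right _ _ (tendsto_neg_atBot_atTop.comp ?_)
    rw [← Real.tendsto_exp_comp_nhds_zero]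
    simpa [Complex.norm_exp] using! h0.norm
  have h1 := ((Real.tendsto_pow_mul_exp_neg_atTop_nhds_zero n).comp hre).mul_const (Real.exp B)
  rw [zero_mul] at h1
  refine squeeze_zero_norm' ?_ h1
  filter_upwards [hB, hre.eventually_ge_atTop B] with t ht ht'
  rw [norm_mul, norm_pow, Complex.norm_exp, Function.comp_apply, mul_assoc, ← Real.exp_add]
  rw [show -(-(ℓ t).re + B) + B = (ℓ t).re by ring]
  refine mul_le_mul_of_nonneg_right (pow_le_pow_left₀ (norm_nonneg _) ?_ n) (Real.exp_pos _).le
  refine (Complex.norm_le_abs_re_add_abs_im _).trans ?_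
  rw [abs_of_nonpos (by linarith : (ℓ t).re ≤ 0)]
  linarith

/-- Each coefficient of H - 1 is u times its difference quotient at 0, which converges, and u = e^ℓ
absorbs powers of ℓ. -/
theorem IsPoleSolution.negligible {f : ι → ℂ → ℂ} {k : ι} {ρ : ℂ} {R : ℝ} (hR : 0 < R)
    {H : ℂ → NCSeries ι} (hH : IsPoleSolution f k ρ R H) {τ : Type*} {l : Filter τ} {ℓ U : τ → ℂ}
    {B : ℝ} (h0 : Tendsto U l (𝓝 0)) (he : ∀ᶠ t in l, Complex.exp (ℓ t) = U t)
    (hB : ∀ᶠ t in l, |(ℓ t).im| ≤ B) : Negligible l ℓ fun t => H (U t) - 1 := by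
  intro v n
  have hexp : Tendsto (fun t => Complex.exp (ℓ t)) l (𝓝 0) := h0.congr' (he.mono fun t ht => ht.symm)
  set p : ℂ → ℂ := fun u => H u v - (1 : NCSeries ι) v with hp
  have hd : DifferentiableAt ℂ p 0 :=
    (((hH.differentiableOn v).differentiableAt (Metric.ball_mem_nhds 0 hR))).sub_const _
  have hp0 : p 0 = 0 := by rw [hp]; simp [hH.zero]
  have hc : Tendsto (fun t => dslope p 0 (U t)) l (𝓝 (dslope p 0 0)) :=
    (continuousAt_dslope_same.2 hd).tendsto.comp h0
  have := (tendsto_pow_mul_exp hexp hB n).mul hc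
  rw [zero_mul] at this
  refine this.congr' (he.mono fun t ht => ?_)
  have hs := sub_smul_dslope p 0 (U t)
  rw [hp0, sub_zero, sub_zero, smul_eq_mul] at hs
  beta_reduce
  rw [NCSeries.sub_apply, ht, mul_assoc, hs]

/-! ### Paths on a Riemann surface in local coordinates -/

section Charts

variable {X : Type*} [TopologicalSpace X] [ChartedSpace ℂ X]

theorem contDiffOn_transition [IsManifold 𝓘(ℂ) ω X] {e e' : OpenPartialHomeomorph X ℂ}
    (he : e ∈ IsManifold.maximalAtlas 𝓘(ℂ) ω X) (he' : e' ∈ IsManifold.maximalAtlas 𝓘(ℂ) ω X) :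
    ContDiffOn ℂ ω (e' ∘ e.symm) (e.target ∩ e.symm ⁻¹' e'.source) := by
  rw [← contMDiffOn_iff_contDiffOn]
  exact (contMDiffOn_of_mem_maximalAtlas he').comp
    ((contMDiffOn_symm_of_mem_maximalAtlas he).mono inter_subset_left) (fun u hu => hu.2)

theorem contDiffWithinAt_chart_change [IsManifold 𝓘(ℂ) ω X] {e e' : OpenPartialHomeomorph X ℂ}
    (he : e ∈ IsManifold.maximalAtlas 𝓘(ℂ) ω X) (he' : e' ∈ IsManifold.maximalAtlas 𝓘(ℂ) ω X)
    {α : ℝ → X} {A : Set ℝ} {t : ℝ} (hc : ContinuousWithinAt α A t) (h : α t ∈ e.source)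
    (h' : α t ∈ e'.source) (hd : ContDiffWithinAt ℝ 1 (e ∘ α) A t) :
    ContDiffWithinAt ℝ 1 (e' ∘ α) A t := by
  have ho : IsOpen (e.target ∩ e.symm ⁻¹' e'.source) :=
    e.isOpen_inter_preimage_symm e'.open_source
  have h1 : ContDiffAt ℝ 1 (e' ∘ e.symm) (e (α t)) := by
    refine ContDiffAt.restrict_scalars ℝ (𝕜' := ℂ) ?_
    refine ((contDiffOn_transition he he').contDiffAt (ho.mem_nhds ?_)).of_le le_top
    exact ⟨e.map_source h, by simpa [e.left_inv h] using h'⟩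
  refine (h1.comp_contDiffWithinAt t hd).congr_of_eventuallyEq ?_ ?_
  · filter_upwards [hc.preimage_mem_nhdsWithin (e.open_source.mem_nhds h)] with s hs
    simp [e.left_inv hs]
  · simp [e.left_inv h]

/-- Smoothness of a path is defined through the preferred charts `chartAt`. Holomorphic transition
maps are C¹ over ℝ, so any chart of the maximal atlas may be used. -/
theorem contMDiffWithinAt_iff_chart [IsManifold 𝓘(ℂ) ω X] {e : OpenPartialHomeomorph X ℂ}
    (he : e ∈ IsManifold.maximalAtlas 𝓘(ℂ) ω X) {α : ℝ → X} {A : Set ℝ} {t : ℝ}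
    (h : α t ∈ e.source) :
    ContMDiffWithinAt 𝓘(ℝ, ℝ) 𝓘(ℝ, ℂ) 1 α A t ↔
      ContinuousWithinAt α A t ∧ ContDiffWithinAt ℝ 1 (e ∘ α) A t := by
  have h0 := IsManifold.chart_mem_maximalAtlas (I := 𝓘(ℂ)) (n := ω) (α t)
  rw [contMDiffWithinAt_iff]
  simp only [mfld_simps]
  refine and_congr_right fun hc => ⟨fun hd => ?_, fun hd => ?_⟩
  · exact contDiffWithinAt_chart_change h0 he hc (mem_chart_source ℂ _) h hd
  · exact contDiffWithinAt_chart_change he h0 hc h (mem_chart_source ℂ _) hd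

/-- The tangent line at `x` is identified with ℂ through `chartAt ℂ x`, so the manifold derivative
is that of a transition map. -/
theorem coeff_chart [IsManifold 𝓘(ℂ) ω X] (η : OneForm X) {e : OpenPartialHomeomorph X ℂ}
    (he : e ∈ IsManifold.maximalAtlas 𝓘(ℂ) ω X) {x : X} (h : x ∈ e.source) :
    η.coeff e (e x) = η x (deriv (chartAt ℂ x ∘ e.symm) (e x) : ℂ) := by
  have hm : MDifferentiableAt 𝓘(ℂ) 𝓘(ℂ) e.symm (e x) :=
    ((contMDiffOn_symm_of_mem_maximalAtlas he).contMDiffAt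
      (e.open_target.mem_nhds (e.map_source h))).mdifferentiableAt (by simp)
  have h1 : ∀ y, y = x → η y (deriv (chartAt ℂ y ∘ e.symm) (e x) : ℂ) =
      η x (deriv (chartAt ℂ x ∘ e.symm) (e x) : ℂ) := by
    rintro y rfl; rfl
  have h2 : (mfderiv 𝓘(ℂ) 𝓘(ℂ) e.symm (e x) : ℂ →L[ℂ] ℂ) = fderivWithin ℂ
      (writtenInExtChartAt 𝓘(ℂ) 𝓘(ℂ) (e x) e.symm) (range 𝓘(ℂ))
      (extChartAt 𝓘(ℂ) (e x) (e x)) := hm.mfderiv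
  simp only [mfld_simps, fderivWithin_univ] at h2
  rw [← h1 _ (e.left_inv h)]
  exact congrArg (fun L : ℂ →L[ℂ] ℂ => η (e.symm (e x)) (L 1 : ℂ)) h2

/-- The function `g` in `α^* η = g dt`, where the velocity is taken within `A`. -/
def OneForm.pullbackWithin (η : OneForm X) (α : ℝ → X) (A : Set ℝ) (t : ℝ) : ℂ :=
  η (α t) (mfderivWithin 𝓘(ℝ, ℝ) 𝓘(ℝ, ℂ) α A t (1 : ℝ) : ℂ)

theorem pullbackWithin_eq_pullback (η : OneForm X) {α : ℝ → X} {A : Set ℝ} {t : ℝ}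
    (h : A ∈ 𝓝 t) : η.pullbackWithin α A t = η.pullback α t := by
  rw [OneForm.pullbackWithin, mfderivWithin_of_mem_nhds h]
  rfl

theorem pullbackWithin_eq [IsManifold 𝓘(ℂ) ω X] (η : OneForm X) {e : OpenPartialHomeomorph X ℂ}
    (he : e ∈ IsManifold.maximalAtlas 𝓘(ℂ) ω X) {α : ℝ → X} {A : Set ℝ} {t : ℝ}
    (hα : ContMDiffWithinAt 𝓘(ℝ, ℝ) 𝓘(ℝ, ℂ) 1 α A t) (hA : UniqueDiffWithinAt ℝ A t)
    (h : α t ∈ e.source) :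
    η.pullbackWithin α A t = η.coeff e (e (α t)) * derivWithin (e ∘ α) A t := by
  have h0 := IsManifold.chart_mem_maximalAtlas (I := 𝓘(ℂ)) (n := ω) (α t)
  have hc := ((contMDiffWithinAt_iff_chart he h).1 hα).1
  have hd := (((contMDiffWithinAt_iff_chart he h).1 hα).2.differentiableWithinAt
    (by simp)).hasDerivWithinAt
  have h1 : mfderivWithin 𝓘(ℝ, ℝ) 𝓘(ℝ, ℂ) α A t (1 : ℝ) =
      derivWithin (chartAt ℂ (α t) ∘ α) A t := by
    have h4 : (mfderivWithin 𝓘(ℝ, ℝ) 𝓘(ℝ, ℂ) α A t : ℝ →L[ℝ] ℂ) = fderivWithin ℝ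
        (writtenInExtChartAt 𝓘(ℝ, ℝ) 𝓘(ℝ, ℂ) t α)
        ((extChartAt 𝓘(ℝ, ℝ) t).symm ⁻¹' A ∩ range 𝓘(ℝ, ℝ)) (extChartAt 𝓘(ℝ, ℝ) t t) :=
      if_pos (hα.mdifferentiableWithinAt (by simp))
    simp only [mfld_simps] at h4
    exact congrArg (fun L : ℝ →L[ℝ] ℂ => L 1) h4
  have h2 : HasDerivAt (chartAt ℂ (α t) ∘ e.symm) (deriv (chartAt ℂ (α t) ∘ e.symm) (e (α t)))
      (e (α t)) := by
    refine DifferentiableAt.hasDerivAt ?_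
    refine ((contDiffOn_transition he h0).contDiffAt ?_).differentiableAt (by simp)
    refine (e.isOpen_inter_preimage_symm (chartAt ℂ (α t)).open_source).mem_nhds
      ⟨e.map_source h, ?_⟩
    simp [e.left_inv h]
  have h3 : derivWithin (chartAt ℂ (α t) ∘ α) A t =
      deriv (chartAt ℂ (α t) ∘ e.symm) (e (α t)) * derivWithin (e ∘ α) A t := by
    refine HasDerivWithinAt.derivWithin ?_ hA
    refine (h2.comp_hasDerivWithinAt t hd).congr_of_eventuallyEq ?_ ?_
    · filter_upwards [hc.preimage_mem_nhdsWithin (e.open_source.mem_nhds h)] with s hs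
      simp [e.left_inv hs]
    · simp [e.left_inv h]
  have h4 : ∀ (L : ℂ →L[ℂ] ℂ) (a b : ℂ), L (a * b) = L a * b := fun L a b => by
    rw [mul_comm, mul_comm (L a)]; exact L.map_smul b a
  rw [coeff_chart η he h, OneForm.pullbackWithin, h1, h3]
  exact h4 (η (α t)) _ _

theorem pullback_eq [IsManifold 𝓘(ℂ) ω X] (η : OneForm X) {e : OpenPartialHomeomorph X ℂ}
    (he : e ∈ IsManifold.maximalAtlas 𝓘(ℂ) ω X) {α : ℝ → X} {t : ℝ}
    (hα : ContMDiffAt 𝓘(ℝ, ℝ) 𝓘(ℝ, ℂ) 1 α t) (h : α t ∈ e.source) :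
    η.pullback α t = η.coeff e (e (α t)) * deriv (e ∘ α) t := by
  rw [← pullbackWithin_eq_pullback η univ_mem, pullbackWithin_eq η he hα uniqueDiffWithinAt_univ h,
    derivWithin_univ]

/-- Velocities within `A` are used because the path c is C¹ only on the closed interval: two-sided
derivatives at its end points carry no information, and continuity up to the ends yields
integrability. -/
theorem continuousOn_pullbackWithin [IsManifold 𝓘(ℂ) ω X] {η : OneForm X} {U : Set X}
    (hη : η.IsHolomorphicOn U) {α : ℝ → X} {A : Set ℝ}
    (hα : ContMDiffOn 𝓘(ℝ, ℝ) 𝓘(ℝ, ℂ) 1 α A) (hA : UniqueDiffOn ℝ A) (hαU : MapsTo α A U) :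
    ContinuousOn (η.pullbackWithin α A) A := by
  intro t ht
  set e := chartAt ℂ (α t)
  have he : e ∈ IsManifold.maximalAtlas 𝓘(ℂ) ω X := IsManifold.chart_mem_maximalAtlas _
  have hts : α t ∈ e.source := mem_chart_source ℂ _
  obtain ⟨V, hV, hVA⟩ := continuousOn_iff'.1 hα.continuousOn e.source e.open_source
  have hVs : ∀ s ∈ A ∩ V, α s ∈ e.source := fun s hs =>
    (hVA.symm ▸ (⟨hs.2, hs.1⟩ : s ∈ V ∩ A) : s ∈ α ⁻¹' e.source ∩ A).1
  have htV : t ∈ V := (hVA ▸ (⟨hts, ht⟩ : t ∈ α ⁻¹' e.source ∩ A) : t ∈ V ∩ A).1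
  have hd : ContDiffOn ℝ 1 (e ∘ α) (A ∩ V) := fun s hs =>
    ((contMDiffWithinAt_iff_chart he (hVs s hs)).1 (hα s hs.1)).2.mono inter_subset_left
  have hd' := hd.continuousOn_derivWithin (hA.inter hV) le_rfl
  have hcoeff : ContinuousOn (fun s => η.coeff e (e (α s))) (A ∩ V) := by
    refine (hη e he).continuousOn.comp hd.continuousOn fun s hs => ⟨e.map_source (hVs s hs), ?_⟩
    simpa [e.left_inv (hVs s hs)] using hαU hs.1
  have hAV : A ∩ V ∈ 𝓝[A] t := inter_mem self_mem_nhdsWithin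
    (mem_nhdsWithin_of_mem_nhds (hV.mem_nhds htV))
  have := ((hcoeff.mul hd') t ⟨ht, htV⟩).mono_of_mem_nhdsWithin hAV
  refine this.congr_of_eventuallyEq ?_ ?_
  · filter_upwards [hAV] with s hs
    rw [Pi.mul_apply, derivWithin_inter (hV.mem_nhds hs.2),
      pullbackWithin_eq η he (hα s hs.1) (hA s hs.1) (hVs s hs)]
  · rw [Pi.mul_apply, derivWithin_inter (hV.mem_nhds htV), pullbackWithin_eq η he (hα t ht) (hA t ht) hts]

end Charts

section Punctures

variable {X : Type*} [TopologicalSpace X] [ChartedSpace ℂ X]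

/-! ### Good punctures -/

-- At the pole, u f(u) has order 0 and hence a limit, which is then the residue; elsewhere f itself
-- has a limit and u tends to 0.
open Classical in
theorem IsGoodPuncture.tendsto_mul_coeff {w : ι → OneForm X} {P : X} {k : ι}
    (h : IsGoodPuncture w P k) {e : OpenPartialHomeomorph X ℂ}
    (he : e ∈ IsManifold.maximalAtlas 𝓘(ℂ) ω X) (hP : P ∈ e.source) (h0 : e P = 0) (a : ι) :
    Tendsto (fun u => u * (w a).coeff e u) (𝓝[≠] 0)
      (𝓝 (if a = k then (w k).residue e else 0)) := by
  have hid : MeromorphicAt (id : ℂ → ℂ) 0 := analyticAt_id.meromorphicAt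
  split_ifs with ha
  · subst ha
    have ho := h.1 e he hP
    rw [h0] at ho
    have hm : MeromorphicAt ((w a).coeff e) 0 := by
      -- A function that is not meromorphic has order 0 by convention, which differs from -1.
      by_contra hm
      rw [meromorphicOrderAt_of_not_meromorphicAt hm] at ho
      exact absurd ho (by decide)
    have ho' : 0 ≤ meromorphicOrderAt (id * (w a).coeff e) 0 := by
      rw [meromorphicOrderAt_mul hid hm, meromorphicOrderAt_id, ho]
      exact le_of_eq rfl
    obtain ⟨c, hc⟩ := tendsto_nhds_of_meromorphicOrderAt_nonneg (hid.mul hm) ho'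
    have hc' : Tendsto (fun u => u * (w a).coeff e u) (𝓝[≠] 0) (𝓝 c) := hc
    rwa [OneForm.residue, hc'.limUnder_eq]
  · obtain ⟨hm, ho⟩ := h.2 a ha e he hP
    rw [h0] at hm ho
    obtain ⟨c, hc⟩ := tendsto_nhds_of_meromorphicOrderAt_nonneg hm ho
    have := (tendsto_id.mono_left (nhdsWithin_le_nhds (a := (0 : ℂ)) (s := {0}ᶜ))).mul hc
    simpa using this

theorem BaseDatum.differentiableOn_coeff {S : Set X} {P : X} {γ : ℝ → X} (b : BaseDatum S P γ)
    {η : OneForm X} (hη : η.IsHolomorphicOn Sᶜ) :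
    DifferentiableOn ℂ (η.coeff b.chart) (Metric.ball 0 b.radius \ {0}) := by
  refine (hη b.chart b.chart_mem).mono fun u hu => ?_
  have hut := b.ball_subset hu.1
  refine ⟨hut, fun hS => hu.2 ?_⟩
  have := b.eq_of_mem _ hS (b.chart.map_target hut) (by rw [b.chart.right_inv hut]; exact hu.1)
  rw [mem_singleton_iff, ← b.chart.right_inv hut, this, b.chart_eq]

theorem BaseDatum.exists_isPoleSolution {S : Set X} {P : X} {γ : ℝ → X} (b : BaseDatum S P γ)
    {w : ι → OneForm X} (hw : ∀ k, (w k).IsHolomorphicOn Sᶜ) {k : ι} (hk : IsGoodPuncture w P k) :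
    ∃ H, IsPoleSolution (fun a => (w a).coeff b.chart) k ((w k).residue b.chart) b.radius H := by
  classical
  refine _root_.exists_isPoleSolution b.radius_pos (fun a => b.differentiableOn_coeff (hw a))
    fun a => ?_
  convert! hk.tendsto_mul_coeff b.chart_mem b.mem_source b.chart_eq a

theorem pullback_congr (η : OneForm X) {α β : ℝ → X} {t : ℝ} (h : α =ᶠ[𝓝 t] β) :
    η.pullback α t = η.pullback β t := by
  have h1 : ∀ x y : X, x = y → ∀ z z' : ℂ, z = z' → η x (z : ℂ) = η y (z' : ℂ) := by
    rintro x y rfl z z' rfl; rfl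
  have h2 : (mfderiv 𝓘(ℝ, ℝ) 𝓘(ℝ, ℂ) α t : ℝ →L[ℝ] ℂ) = mfderiv 𝓘(ℝ, ℝ) 𝓘(ℝ, ℂ) β t :=
    h.mfderiv_eq
  exact h1 _ _ h.self_of_nhds _ _ (congrArg (fun L : ℝ →L[ℝ] ℂ => L 1) h2)

theorem IsPuncturePath.reverse {S : Set X} {P Q : X} {γ : ℝ → X} (h : IsPuncturePath S P Q γ) :
    IsPuncturePath S Q P (reversePath γ) where
  continuousOn := h.continuousOn.comp (by fun_prop) fun t ht =>
    ⟨by linarith [ht.2], by linarith [ht.1]⟩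
  source := by simp [reversePath, h.target]
  target := by simp [reversePath, h.source]
  contMDiffOn := h.contMDiffOn.comp
    (contMDiff_iff_contDiff.2 (by fun_prop : ContDiff ℝ 1 fun t : ℝ => 1 - t)).contMDiffOn
    fun t ht => ⟨by linarith [ht.2], by linarith [ht.1]⟩
  notMem t ht := h.notMem _ ⟨by linarith [ht.2], by linarith [ht.1]⟩

theorem pullback_followPath_of_lt (η : OneForm X) {γ c : ℝ → X} {t₀ t : ℝ} (ht : t < t₀) :
    η.pullback (followPath γ t₀ c) t = η.pullback γ t := by
  refine pullback_congr η ?_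
  filter_upwards [Iio_mem_nhds ht] with s hs
  exact if_pos (le_of_lt hs)

variable [IsManifold 𝓘(ℂ) ω X]

/-- Along a path in a coordinate disc, the local solution is a solution. -/
theorem IsPoleSolution.isSolution_pullback {w : ι → OneForm X} {e : OpenPartialHomeomorph X ℂ}
    (he : e ∈ IsManifold.maximalAtlas 𝓘(ℂ) ω X) {k : ι} {ρ : ℂ} {R : ℝ} {H : ℂ → NCSeries ι}
    (hH : IsPoleSolution (fun a => (w a).coeff e) k ρ R H) {α : ℝ → X} {A : Set ℝ} {L : ℝ → ℂ}
    (hα : ContMDiffOn 𝓘(ℝ, ℝ) 𝓘(ℝ, ℂ) 1 α A)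
    (hαR : ∀ t ∈ A, α t ∈ e.source ∧ e (α t) ∈ Metric.ball 0 R)
    (hL : ContinuousOn L A) (hexp : ∀ t ∈ A, Complex.exp (L t) = e (α t)) :
    IsSolution (fun a => (w a).pullback α) A ∅
      (fun t => H (e (α t)) * NCSeries.expSeries k (ρ * L t)) := by
  have hC : ∀ t ∈ interior A, ContMDiffAt 𝓘(ℝ, ℝ) 𝓘(ℝ, ℂ) 1 α t := fun t ht =>
    hα.contMDiffAt (mem_interior_iff_mem_nhds.1 ht)
  refine (hH.isSolution (U := e ∘ α) (U' := deriv (e ∘ α)) ?_ (fun t ht => (hαR t ht).2)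
    (fun t ht => ?_) hL hexp).congr_coeff fun a t ht => ?_
  · exact e.continuousOn.comp hα.continuousOn fun t ht => (hαR t ht).1
  · have := ((contMDiffWithinAt_iff_chart he (hαR t (interior_subset ht)).1).1 (hC t ht)).2
    exact (ContDiffAt.differentiableAt this (by simp)).hasDerivAt
  · exact (pullback_eq (w a) he (hC t ht.1) (hαR t (interior_subset ht.1)).1).symm

/-! ### Pullbacks along reparametrized and composed paths -/

theorem pullback_comp (η : OneForm X) {α : ℝ → X} {φ : ℝ → ℝ} {φ' t : ℝ}
    (hα : ContMDiffAt 𝓘(ℝ, ℝ) 𝓘(ℝ, ℂ) 1 α (φ t)) (hφ : ContDiffAt ℝ 1 φ t)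
    (hφ' : HasDerivAt φ φ' t) :
    η.pullback (α ∘ φ) t = φ' * η.pullback α (φ t) := by
  have he := IsManifold.chart_mem_maximalAtlas (I := 𝓘(ℂ)) (n := ω) (α (φ t))
  have hs := mem_chart_source ℂ (α (φ t))
  have hd : DifferentiableAt ℝ (chartAt ℂ (α (φ t)) ∘ α) (φ t) :=
    ContDiffAt.differentiableAt ((contMDiffWithinAt_iff_chart he hs).1 hα).2 (by simp)
  have hcomp : ContMDiffAt 𝓘(ℝ, ℝ) 𝓘(ℝ, ℂ) 1 (α ∘ φ) t := hα.comp t hφ.contMDiffAt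
  rw [pullback_eq η he hcomp hs, pullback_eq η he hα hs, ← Function.comp_assoc]
  rw [(hd.hasDerivAt.scomp t hφ').deriv, Complex.real_smul, Function.comp_apply]
  ring

/-- Interval integrals ignore end points, so integrability passes from one-sided to two-sided
velocities by comparison on the open interval. -/
theorem isRegularCoeff_pullback {S : Set X} {w : ι → OneForm X}
    (hw : ∀ k, (w k).IsHolomorphicOn Sᶜ) {α : ℝ → X} {A : Set ℝ}
    (hα : ContMDiffOn 𝓘(ℝ, ℝ) 𝓘(ℝ, ℂ) 1 α A) (hA : UniqueDiffOn ℝ A) (hA' : A.OrdConnected)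
    (hαS : ∀ t ∈ A, α t ∉ S) : IsRegularCoeff (fun a => (w a).pullback α) A ∅ where
  ordConnected := hA'
  countable := countable_empty
  continuousAt a t ht := by
    have hc := continuousOn_pullbackWithin (hw a) hα hA hαS
    refine (hc.continuousAt (mem_interior_iff_mem_nhds.1 ht.1)).congr ?_
    filter_upwards [isOpen_interior.mem_nhds ht.1] with s hs
    exact pullbackWithin_eq_pullback _ (mem_interior_iff_mem_nhds.1 hs)
  intervalIntegrable a s hs t ht := by
    have hc := (continuousOn_pullbackWithin (hw a) hα hA hαS).mono (hA'.uIcc_subset hs ht)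
    refine hc.intervalIntegrable.congr_uIoo fun x hx => ?_
    refine pullbackWithin_eq_pullback _ ?_
    exact mem_of_superset (isOpen_Ioo.mem_nhds hx) (Ioo_subset_Icc_self.trans
      (hA'.uIcc_subset hs ht))

section FollowPath

variable {γ c : ℝ → X} {t₀ : ℝ}

theorem pullback_followPath_add (η : OneForm X)
    (hc : ContMDiffOn 𝓘(ℝ, ℝ) 𝓘(ℝ, ℂ) 1 c (Icc 0 1)) {s : ℝ} (hs : s ∈ Ioo (0 : ℝ) 1) :
    η.pullback (followPath γ t₀ c) (t₀ + s) = η.pullback c s := by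
  have h1 : followPath γ t₀ c =ᶠ[𝓝 (t₀ + s)] c ∘ fun t => t - t₀ := by
    filter_upwards [Ioi_mem_nhds (lt_add_of_pos_right t₀ hs.1)] with x hx
    exact if_neg (not_le.2 hx)
  have h2 : ContMDiffAt 𝓘(ℝ, ℝ) 𝓘(ℝ, ℂ) 1 c ((fun t => t - t₀) (t₀ + s)) := by
    simpa using hc.contMDiffAt (Icc_mem_nhds hs.1 hs.2)
  rw [pullback_congr η h1, pullback_comp η (φ := fun t => t - t₀) h2 (φ' := 1) (by fun_prop)
    ((hasDerivAt_id _).sub_const t₀)]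
  simp

/-- The concatenation may have a corner at `t₀`, hence the exceptional set. Integrability is proved
from `t₀` outwards on each piece and then concatenated. -/
theorem isRegularCoeff_followPath {S : Set X} {w : ι → OneForm X}
    (hw : ∀ k, (w k).IsHolomorphicOn Sᶜ)
    (hγ : ContMDiffOn 𝓘(ℝ, ℝ) 𝓘(ℝ, ℂ) 1 γ (Ioo 0 1)) (hγS : ∀ t ∈ Ioo (0 : ℝ) 1, γ t ∉ S)
    (hc : ContMDiffOn 𝓘(ℝ, ℝ) 𝓘(ℝ, ℂ) 1 c (Icc 0 1)) (hcS : ∀ s ∈ Icc (0 : ℝ) 1, c s ∉ S)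
    (ht₀ : t₀ ∈ Ioo (0 : ℝ) 1) :
    IsRegularCoeff (fun a => (w a).pullback (followPath γ t₀ c)) (Ioc 0 (t₀ + 1)) {t₀} := by
  have hrγ := isRegularCoeff_pullback hw hγ isOpen_Ioo.uniqueDiffOn ordConnected_Ioo hγS
  have hrc := isRegularCoeff_pullback hw hc (uniqueDiffOn_Icc zero_lt_one) ordConnected_Icc hcS
  have hadd : ∀ a, ∀ t ∈ Ioo t₀ (t₀ + 1),
      (w a).pullback (followPath γ t₀ c) t = (w a).pullback c (t - t₀) := by
    intro a t ht
    have := pullback_followPath_add (γ := γ) (t₀ := t₀) (w a) hc (s := t - t₀)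
      ⟨by linarith [ht.1], by linarith [ht.2]⟩
    rwa [add_sub_cancel] at this
  have hint : ∀ a, ∀ s ∈ Ioc 0 (t₀ + 1), IntervalIntegrable
      ((w a).pullback (followPath γ t₀ c)) MeasureTheory.volume t₀ s := by
    intro a s hs
    rcases le_total s t₀ with h | h
    · refine (hrγ.intervalIntegrable a t₀ ht₀ s ⟨hs.1, h.trans_lt ht₀.2⟩).congr_uIoo fun x hx => ?_
      rw [uIoo_of_ge h] at hx
      exact (pullback_followPath_of_lt (w a) hx.2).symm
    · have h1 := (hrc.intervalIntegrable a 0 ⟨le_rfl, zero_le_one⟩ (s - t₀)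
        ⟨by linarith, by linarith [hs.2]⟩).comp_sub_right t₀
      simp only [zero_add, sub_add_cancel] at h1
      refine h1.congr_uIoo fun x hx => ?_
      rw [uIoo_of_le h] at hx
      exact (hadd a x ⟨hx.1, hx.2.trans_le hs.2⟩).symm
  refine ⟨ordConnected_Ioc, countable_singleton t₀, fun a t ht => ?_, fun a s hs t ht =>
    (hint a s hs).symm.trans (hint a t ht)⟩
  rw [interior_Ioc] at ht
  rcases lt_or_gt_of_ne (show t ≠ t₀ from ht.2) with h | h
  · have h1 := hrγ.continuousAt a t ⟨by rw [interior_Ioo]; exact ⟨ht.1.1, h.trans ht₀.2⟩, by simp⟩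
    refine h1.congr ?_
    filter_upwards [Iio_mem_nhds h] with x hx
    exact (pullback_followPath_of_lt (w a) hx).symm
  · have h1 := hrc.continuousAt a (t - t₀)
      ⟨by rw [interior_Icc]; exact ⟨by linarith, by linarith [ht.1.2]⟩, by simp⟩
    have h2 : ContinuousAt (fun x => (w a).pullback c (x - t₀)) t :=
      ContinuousAt.comp (f := fun x => x - t₀) h1 (by fun_prop)
    refine h2.congr ?_
    filter_upwards [isOpen_Ioo.mem_nhds ⟨h, ht.1.2⟩] with x hx
    exact (hadd a x hx).symm

end FollowPath

/-! ### Paths between punctures -/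

theorem pullback_reversePath {S : Set X} {P Q : X} {γ : ℝ → X} (h : IsPuncturePath S P Q γ)
    (η : OneForm X) {t : ℝ} (ht : t ∈ Ioo (0 : ℝ) 1) :
    η.pullback (reversePath γ) (1 - t) = -η.pullback γ t := by
  have h1 : ContMDiffAt 𝓘(ℝ, ℝ) 𝓘(ℝ, ℂ) 1 γ ((fun s => 1 - s) (1 - t)) := by
    simpa using h.contMDiffOn.contMDiffAt (isOpen_Ioo.mem_nhds ht)
  have := pullback_comp η (φ := fun s => 1 - s) h1 (φ' := -1) (by fun_prop) ((hasDerivAt_id _).const_sub 1)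
  rw [sub_sub_cancel] at this
  simpa only [Complex.ofReal_neg, Complex.ofReal_one, neg_one_mul] using! this

theorem IsPuncturePath.isRegularCoeff {S : Set X} {P Q : X} {γ : ℝ → X}
    (h : IsPuncturePath S P Q γ) {w : ι → OneForm X} (hw : ∀ k, (w k).IsHolomorphicOn Sᶜ) :
    IsRegularCoeff (fun a => (w a).pullback γ) (Ioo 0 1) ∅ :=
  isRegularCoeff_pullback hw h.contMDiffOn isOpen_Ioo.uniqueDiffOn ordConnected_Ioo h.notMem

/-- A solution along the reversed path is a solution along the path. -/
theorem IsSolution.reverse {S : Set X} {P Q : X} {γ : ℝ → X} (h : IsPuncturePath S P Q γ)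
    {w : ι → OneForm X} {F : ℝ → NCSeries ι}
    (hF : IsSolution (fun a => (w a).pullback (reversePath γ)) (Ioo 0 1) ∅ F) :
    IsSolution (fun a => (w a).pullback γ) (Ioo 0 1) ∅ fun t => F (1 - t) := by
  have hm : ∀ t ∈ Ioo (0 : ℝ) 1, 1 - t ∈ Ioo (0 : ℝ) 1 := fun t ht =>
    ⟨by linarith [ht.2], by linarith [ht.1]⟩
  refine ⟨fun t ht => hF.nil _ (hm t ht), fun v => ?_, fun t ht a v => ?_⟩
  · exact (hF.continuousOn v).comp (by fun_prop) hm
  · rw [interior_Ioo, sdiff_empty] at ht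
    have h1 := hF.hasDerivAt (1 - t) ⟨by rw [interior_Ioo]; exact hm t ht, by simp⟩ a v
    rw [pullback_reversePath h (w a) ht] at h1
    refine (h1.scomp t ((hasDerivAt_id t).const_sub 1)).congr_deriv ?_
    simp

end Punctures

/-! ### Expanding products with an exponential -/

namespace NCSeries

theorem sum_apply {κ : Type*} (s : Finset κ) (f : κ → NCSeries ι) (v : List ι) :
    (∑ i ∈ s, f i) v = ∑ i ∈ s, f i v := by
  classical
  induction s using Finset.induction_on with
  | empty => rfl
  | insert i s hi ih => rw [Finset.sum_insert hi, Finset.sum_insert hi, add_apply, ih]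

/-- Only prefixes that are powers of k contribute, and since `v` does not begin with k they have at
most `a` letters. -/
theorem expSeries_mul_replicate_append (k : ι) (z : ℂ) (f : NCSeries ι) (a : ℕ) {v : List ι}
    (hv : ¬ [k] <+: v) :
    (expSeries k z * f) (List.replicate a k ++ v) = ∑ n ∈ Finset.range (a + 1),
      z ^ n / (n.factorial : ℂ) * f (List.replicate (a - n) k ++ v) := by
  rw [mul_apply]
  symm
  refine (Finset.sum_congr rfl fun n hn => ?_).trans (Finset.sum_subset ?_ ?_)
  · have hna : n ≤ a := Nat.lt_succ_iff.1 (Finset.mem_range.1 hn)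
    rw [List.take_append_of_le_length (by simpa using hna), List.take_replicate, min_eq_left hna,
      List.drop_append_of_le_length (by simpa using hna), List.drop_replicate,
      expSeries_replicate]
  · intro n hn
    simp only [Finset.mem_range, List.length_append, List.length_replicate] at hn ⊢
    omega
  · intro n hn hna
    simp only [Finset.mem_range, List.length_append, List.length_replicate, not_lt] at hn hna
    cases v with
    | nil => simp only [List.length_nil] at hn; omega
    | cons b v =>
      rw [expSeries, if_neg, zero_mul]
      intro h
      have hb : b = k := by
        refine h b ?_
        obtain ⟨m, rfl⟩ : ∃ m, n = a + 1 + m := ⟨n - (a + 1), by omega⟩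
        rw [List.take_append, List.length_replicate,
          show a + 1 + m - a = m + 1 by omega, List.take_succ_cons]
        simp
      subst hb
      exact hv (by simp)

/-- The part of `exp (ρ x_k)` of degree `s`. -/
def expPart (k : ι) (ρ : ℂ) (s : ℕ) : NCSeries ι :=
  fun v => if v.length = s then expSeries k ρ v else 0

theorem expPart_zero (k : ι) (ρ : ℂ) : expPart k ρ 0 = 1 := by
  ext v
  cases v <;> simp [expPart, expSeries_nil, one_nil, one_cons]

theorem mul_congr {f f' g g' : NCSeries ι} {N : ℕ} (hf : ∀ v, v.length ≤ N → f v = f' v)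
    (hg : ∀ v, v.length ≤ N → g v = g' v) {v : List ι} (hv : v.length ≤ N) :
    (f * g) v = (f' * g') v := by
  rw [mul_apply, mul_apply]
  refine Finset.sum_congr rfl fun n _ => ?_
  rw [hf _ ((List.length_take_le' n v).trans hv), hg _ (by simp; omega)]

/-- A coefficient of a product sees only words of at most that length (`mul_congr`), so the
exponential may be truncated to a polynomial in z. -/
theorem mul_expSeries_mul_apply (F Φ : NCSeries ι) (k : ι) (ρ z : ℂ) (v : List ι) :
    (F * expSeries k (ρ * z) * Φ) v =
      ∑ s ∈ Finset.range (v.length + 1), (F * expPart k ρ s * Φ) v * z ^ s := by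
  have h : ∀ w : List ι, w.length ≤ v.length → expSeries k (ρ * z) w =
      (∑ s ∈ Finset.range (v.length + 1), z ^ s • expPart k ρ s) w := by
    intro w hw
    rw [sum_apply, Finset.sum_eq_single_of_mem w.length (Finset.mem_range.2 (by omega))]
    · rw [smul_apply, expPart, if_pos rfl, expSeries_mul_apply, mul_comm]
    · intro s _ hs
      rw [smul_apply, expPart, if_neg (Ne.symm hs), mul_zero]
  rw [mul_congr (fun w hw => mul_congr (fun _ _ => rfl) h hw) (fun _ _ => rfl) le_rfl]
  rw [Finset.mul_sum, Finset.sum_mul, sum_apply]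
  refine Finset.sum_congr rfl fun s _ => ?_
  rw [mul_smul_comm, smul_mul_assoc, smul_apply, mul_comm]

end NCSeries

/-! ### Regularized series as values of solutions -/

section Main

variable {X : Type*} [TopologicalSpace X] [ChartedSpace ℂ X]

theorem iterInt_eq_transport (w : ι → OneForm X) (γ : ℝ → X) (ε : ℝ) (v : List ι) (T : ℝ) :
    iterInt w γ ε v T = transport (fun a => (w a).pullback γ) ε T v := by
  induction v generalizing T with
  | nil => rfl
  | cons a v ih => simp only [iterInt, transport_cons, ih]

/-- The limits give the coefficients of F(T) at k and at words not ending in k; as F(T) is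
group-like, these determine it by the formula that defines `regSeries`. -/
theorem regularizationConverges_and_regSeries_eq {w : ι → OneForm X} {k : ι} {ρ : ℂ} {log : ℝ → ℂ}
    {α : ℝ → X} {T : ℝ} {N : Set ℝ} {F H : ℝ → NCSeries ι} (hT : 0 < T)
    (hg : IsRegularCoeff (fun a => (w a).pullback α) (Ioc 0 T) N)
    (hF : IsSolution (fun a => (w a).pullback α) (Ioc 0 T) N F)
    (hFH : ∀ᶠ t in 𝓝[>] (0 : ℝ), F t = H t * expSeries k (ρ * log t)) (hH : ∀ t, H t [] = 1)
    (hN : Negligible (𝓝[>] (0 : ℝ)) log fun t => H t - 1) :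
    RegularizationConverges w k ρ log α T ∧ regSeries w k ρ log α T = F T := by
  have h1 := tendsto_transport_singleton hT hg hF hFH hH hN
  have h2 := fun v (hv : ¬ [k] <:+ v) =>
    tendsto_transport_of_not_suffix hT hg hF hFH hH hN hv
  simp only [← iterInt_eq_transport] at h1 h2
  refine ⟨⟨⟨_, h1⟩, fun v hv => ⟨_, h2 v hv⟩⟩, ?_⟩
  have hG := isGroupLike_of_asymptotics hT hg hF hFH hN
  ext v
  rw [← hG.shuffleDecomp_sum k v, regSeries, regInt, h1.limUnder_eq]
  refine Finsupp.sum_congr fun i _ => ?_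
  congr 1
  refine Finsupp.sum_congr fun u hu => ?_
  rw [convInt, (h2 u ((isShuffleDecomp_shuffleDecomp k v).1 i u hu)).limUnder_eq]

theorem NearEnd.exp_logCoord {S : Set X} {P : X} {γ : ℝ → X} {b : BaseDatum S P (reversePath γ)}
    (κ : NearEnd b) : Complex.exp κ.logCoord = κ.coord :=
  κ.exp_log 1 ⟨zero_le_one, le_rfl⟩

variable [IsManifold 𝓘(ℂ) ω X]

/-- The local solution is extended over all of (0, 1) by transport from `b.time / 2`; uniqueness
identifies the two near the puncture. -/
theorem exists_solution_at_puncture {S : Set X} {w : ι → OneForm X}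
    (hw : ∀ k, (w k).IsHolomorphicOn Sᶜ) {P Q : X} {γ : ℝ → X} (hγ : IsPuncturePath S P Q γ)
    (b : BaseDatum S P γ) {k : ι} {ρ : ℂ} {H : ℂ → NCSeries ι}
    (hH : IsPoleSolution (fun a => (w a).coeff b.chart) k ρ b.radius H) :
    ∃ M : ℝ → NCSeries ι, IsSolution (fun a => (w a).pullback γ) (Ioo 0 1) ∅ M ∧
      ∀ t ∈ Ioo 0 b.time, M t = H (b.chart (γ t)) * expSeries k (ρ * b.log t) := by
  have hsub : Ioo 0 b.time ⊆ Ioo 0 1 := Ioo_subset_Ioo_right b.time_le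
  have hG := hH.isSolution_pullback b.chart_mem (hγ.contMDiffOn.mono hsub) b.mapsTo
    b.log_continuousOn b.exp_log
  have ht : b.time / 2 ∈ Ioo 0 b.time := ⟨half_pos b.time_pos, half_lt_self b.time_pos⟩
  set C := H (b.chart (γ (b.time / 2))) * expSeries k (ρ * b.log (b.time / 2)) with hC
  have hM := ((hγ.isRegularCoeff hw).isSolution_transport (hsub ht)).mul_const C (hG.nil _ ht)
  refine ⟨_, hM, fun t ht' => ?_⟩
  exact (hM.mono hsub).eqOn hG ordConnected_Ioo countable_empty ht
    (by rw [transport_self, one_mul, hC]) ht'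

/-- The regularized series is the normalized solution at `t₀`, continued along c. All dependence on
c is a left factor, common to both end points of γ. -/
theorem regSeries_followPath {S : Set X} {w : ι → OneForm X}
    (hw : ∀ k, (w k).IsHolomorphicOn Sᶜ) {P Q : X} {γ : ℝ → X} (hγ : IsPuncturePath S P Q γ)
    (b : BaseDatum S P γ) {k : ι} {ρ : ℂ} {H : ℂ → NCSeries ι}
    (hH : IsPoleSolution (fun a => (w a).coeff b.chart) k ρ b.radius H) {M : ℝ → NCSeries ι}
    (hM : IsSolution (fun a => (w a).pullback γ) (Ioo 0 1) ∅ M)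
    (hMH : ∀ t ∈ Ioo 0 b.time, M t = H (b.chart (γ t)) * expSeries k (ρ * b.log t))
    {t₀ : ℝ} (ht₀ : t₀ ∈ Ioo (0 : ℝ) 1) {c : ℝ → X}
    (hc : ContMDiffOn 𝓘(ℝ, ℝ) 𝓘(ℝ, ℂ) 1 c (Icc 0 1)) (hcS : ∀ s ∈ Icc (0 : ℝ) 1, c s ∉ S) :
    RegularizationConverges w k ρ b.log (followPath γ t₀ c) (t₀ + 1) ∧
      regSeries w k ρ b.log (followPath γ t₀ c) (t₀ + 1) =
        transport (fun a => (w a).pullback c) 0 1 * M t₀ := by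
  have hT : 0 < t₀ + 1 := by linarith [ht₀.1]
  have htT : t₀ ∈ Ioc 0 (t₀ + 1) := ⟨ht₀.1, by linarith⟩
  have hg := isRegularCoeff_followPath hw hγ.contMDiffOn hγ.notMem hc hcS ht₀
  have hF := (hg.isSolution_transport htT).mul_const (M t₀) (hM.nil t₀ ht₀)
  set F : ℝ → NCSeries ι := fun t =>
    transport (fun a => (w a).pullback (followPath γ t₀ c)) t₀ t * M t₀ with hFdef
  have hF₀ : F t₀ = M t₀ := by rw [hFdef]; simp [transport_self]
  have hFM : ∀ t ∈ Ioc 0 t₀, F t = M t := by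
    intro t ht
    have h1 : IsSolution (fun a => (w a).pullback γ) (Ioc 0 t₀) {t₀} F := by
      refine (hF.mono (Ioc_subset_Ioc_right (by linarith))).congr_coeff fun a x hx => ?_
      rw [interior_Ioc] at hx
      exact pullback_followPath_of_lt (w a) hx.1.2
    have h2 : IsSolution (fun a => (w a).pullback γ) (Ioc 0 t₀) {t₀} M := by
      have := hM.mono (B := Ioc 0 t₀) fun x hx => ⟨hx.1, hx.2.trans_lt ht₀.2⟩
      exact ⟨this.nil, this.continuousOn, fun x hx => this.hasDerivAt x ⟨hx.1, by simp⟩⟩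
    exact h1.eqOn h2 ordConnected_Ioc (countable_singleton _) ⟨ht₀.1, le_rfl⟩ hF₀ ht
  have hsmall : ∀ᶠ t in 𝓝[>] (0 : ℝ), t ∈ Ioo 0 b.time := Ioo_mem_nhdsGT b.time_pos
  have hU : Tendsto (fun t => b.chart (γ t)) (𝓝[>] (0 : ℝ)) (𝓝 0) := by
    have h1 : Tendsto γ (𝓝[>] 0) (𝓝 P) := by
      rw [← hγ.source]
      refine (hγ.continuousOn 0 ⟨le_rfl, zero_le_one⟩).mono_left ?_
      rw [← nhdsWithin_Ioo_eq_nhdsGT (zero_lt_one' ℝ)]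
      exact nhdsWithin_mono _ Ioo_subset_Icc_self
    have h2 := (b.chart.continuousAt b.mem_source).tendsto.comp h1
    rwa [b.chart_eq] at h2
  obtain ⟨B, hB⟩ := b.log_bounded
  have hneg : Negligible (𝓝[>] (0 : ℝ)) b.log fun t => H (b.chart (γ t)) - 1 :=
    hH.negligible b.radius_pos hU (hsmall.mono fun t ht => b.exp_log t ht)
      (hsmall.mono fun t ht => hB t ht)
  have hFH : ∀ᶠ t in 𝓝[>] (0 : ℝ), F t = H (b.chart (γ t)) * expSeries k (ρ * b.log t) := by
    filter_upwards [hsmall, Ioc_mem_nhdsGT ht₀.1] with t ht ht'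
    rw [hFM t ht', hMH t ht]
  have hmain := regularizationConverges_and_regSeries_eq hT hg hF hFH (fun t => hH.nil _) hneg
  refine ⟨hmain.1, hmain.2.trans ?_⟩
  have hrc := isRegularCoeff_pullback hw hc (uniqueDiffOn_Icc zero_lt_one) ordConnected_Icc hcS
  have hadd : ∀ s ∈ Icc (0 : ℝ) 1, t₀ + s ∈ Ioc 0 (t₀ + 1) := fun s hs =>
    ⟨by linarith [ht₀.1, hs.1], by linarith [hs.2]⟩
  -- After shifting time by `t₀`, the second piece of `F` is a solution along c, so its end value is
  -- the transport along c of `M t₀`.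
  have hsol : IsSolution (fun a => (w a).pullback c) (Icc 0 1) ∅ fun s => F (t₀ + s) := by
    refine ⟨fun s hs => hF.nil _ (hadd s hs), fun v =>
      (hF.continuousOn v).comp (by fun_prop) hadd, fun s hs a v => ?_⟩
    rw [interior_Icc, sdiff_empty] at hs
    have h1 := hF.hasDerivAt (t₀ + s) ⟨by
      rw [interior_Ioc]; exact ⟨by linarith [ht₀.1, hs.1], by linarith [hs.2]⟩, by
      simpa using hs.1.ne'⟩ a v
    rw [pullback_followPath_add (w a) hc hs] at h1
    refine (h1.scomp s ((hasDerivAt_id s).const_add t₀)).congr_deriv ?_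
    simp
  have := hrc.eq_transport_mul hsol (s := 0) (t := 1) ⟨le_rfl, zero_le_one⟩ ⟨zero_le_one, le_rfl⟩
  rw [add_zero, hF₀] at this
  exact this

/-! ### Determinations near the end point -/

/-- Inside the coordinate disc the explicit local solution continues along c with the continued
logarithm; `start` and `log_start` match the initial values. -/
theorem NearEnd.transport_mul {S : Set X} {P : X} {γ : ℝ → X} {b : BaseDatum S P (reversePath γ)}
    (κ : NearEnd b) {w : ι → OneForm X} (hw : ∀ k, (w k).IsHolomorphicOn Sᶜ) {k : ι} {ρ : ℂ}
    {H : ℂ → NCSeries ι} (hH : IsPoleSolution (fun a => (w a).coeff b.chart) k ρ b.radius H)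
    {M : ℝ → NCSeries ι}
    (hMH : ∀ t ∈ Ioo 0 b.time, M t = H (b.chart (reversePath γ t)) * expSeries k (ρ * b.log t)) :
    transport (fun a => (w a).pullback κ.c) 0 1 * M (1 - κ.time) =
      H κ.coord * expSeries k (ρ * κ.logCoord) := by
  have hsol := hH.isSolution_pullback b.chart_mem κ.contMDiffOn κ.mapsTo κ.log_continuousOn κ.exp_log
  have hrc := isRegularCoeff_pullback hw κ.contMDiffOn (uniqueDiffOn_Icc zero_lt_one)
    ordConnected_Icc κ.notMem
  have h := hrc.eq_transport_mul hsol (s := 0) (t := 1) ⟨le_rfl, zero_le_one⟩ ⟨zero_le_one, le_rfl⟩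
  rw [hMH _ ⟨by linarith [κ.time_mem.2], κ.late⟩, ← κ.log_start, reversePath, sub_sub_cancel,
    ← κ.start]
  exact h.symm

/-- Every logarithm of a point of the punctured coordinate disc belongs to a determination. -/
theorem exists_nearEnd {S : Set X} {P : X} {γ : ℝ → X}
    (b : BaseDatum S P (reversePath γ)) {ℓ : ℂ} (hℓ : Real.exp ℓ.re < b.radius) :
    ∃ κ : NearEnd b, κ.logCoord = ℓ := by
  set τ := b.time / 2 with hτ
  have hτ0 : 0 < τ := half_pos b.time_pos
  have hτ1 : τ < b.time := half_lt_self b.time_pos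
  have hτle := b.time_le
  have hexp0 := b.exp_log τ ⟨hτ0, hτ1⟩
  obtain ⟨hs0, hb0⟩ := b.mapsTo τ ⟨hτ0, hτ1⟩
  -- A straight segment in the logarithmic plane: its exponential never vanishes, and it stays in
  -- the disc because the real part is a convex combination.
  set L : ℝ → ℂ := fun s => b.log τ + s * (ℓ - b.log τ) with hL
  have hball : ∀ s ∈ Icc (0 : ℝ) 1, Complex.exp (L s) ∈ Metric.ball (0 : ℂ) b.radius := by
    intro s hs
    rw [← hexp0, mem_ball_zero_iff, Complex.norm_exp, ← Real.lt_log_iff_exp_lt b.radius_pos] at hb0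
    rw [← Real.lt_log_iff_exp_lt b.radius_pos] at hℓ
    rw [mem_ball_zero_iff, Complex.norm_exp, ← Real.lt_log_iff_exp_lt b.radius_pos]
    have h1 : (L s).re = (1 - s) * (b.log τ).re + s * ℓ.re := by
      simp [hL]; ring
    rw [h1]
    rcases eq_or_lt_of_le hs.1 with h | h
    · subst h; simpa using hb0
    · nlinarith [hs.2]
  have hcsrc : ∀ s ∈ Icc (0 : ℝ) 1, b.chart.symm (Complex.exp (L s)) ∈ b.chart.source :=
    fun s hs => b.chart.map_target (b.ball_subset (hball s hs))
  have hright : ∀ s ∈ Icc (0 : ℝ) 1, b.chart (b.chart.symm (Complex.exp (L s))) =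
      Complex.exp (L s) := fun s hs => b.chart.right_inv (b.ball_subset (hball s hs))
  have hLd : ContDiff ℝ 1 fun s => Complex.exp (L s) := by
    refine ContDiff.cexp ?_
    exact contDiff_const.add (Complex.ofRealCLM.contDiff.mul contDiff_const)
  refine ⟨{
    time := 1 - τ
    time_mem := ⟨by linarith, by linarith⟩
    c := fun s => b.chart.symm (Complex.exp (L s))
    contMDiffOn := fun s hs => ?_
    start := ?_
    notMem := fun s hs hS => ?_
    late := by linarith
    mapsTo := fun s hs => ⟨hcsrc s hs, by rw [hright s hs]; exact hball s hs⟩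
    log := L
    log_continuousOn := by rw [hL]; fun_prop
    exp_log := fun s hs => (hright s hs).symm
    log_start := by simp [hL] }, ?_⟩
  · refine (contMDiffWithinAt_iff_chart b.chart_mem (hcsrc s hs)).2 ⟨?_, ?_⟩
    · exact ((b.chart.continuousAt_symm (b.ball_subset (hball s hs))).comp
        (f := fun s => Complex.exp (L s)) hLd.continuous.continuousAt).continuousWithinAt
    · exact hLd.contDiffAt.contDiffWithinAt.congr (fun x hx => hright x hx) (hright s hs)
  · have : L 0 = b.log τ := by simp [hL]
    rw [this, hexp0, b.chart.left_inv hs0]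
    rfl
  · have hP := b.eq_of_mem _ hS (hcsrc s hs) (by rw [hright s hs]; exact hball s hs)
    have h1 := hright s hs
    rw [hP, b.chart_eq] at h1
    exact Complex.exp_ne_zero _ h1.symm
  · simp [NearEnd.logCoord, hL]

/-- At a fixed u ≠ 0 the difference of two expansions is a polynomial in log u vanishing at log u +
2πin for all natural n. Hence it is zero, and the log-free coefficients agree. -/
theorem IsRegularizedLimit.unique {S : Set X} {P : X} {γ : ℝ → X}
    {b : BaseDatum S P (reversePath γ)} {f : Continuation S γ → ℂ} {m m' : ℂ}
    (h : IsRegularizedLimit b f m) (h' : IsRegularizedLimit b f m') : m = m' := by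
  obtain ⟨t, a, -, ha, hm⟩ := h
  obtain ⟨t', a', -, ha', hm'⟩ := h'
  have key : ∀ u ∈ Metric.ball (0 : ℂ) b.radius, u ≠ 0 → a 0 u = a' 0 u := by
    intro u hu hu0
    set p : Polynomial ℂ := (∑ s ∈ Finset.range (t + 1), Polynomial.C (a s u) * Polynomial.X ^ s) -
      ∑ s ∈ Finset.range (t' + 1), Polynomial.C (a' s u) * Polynomial.X ^ s with hp
    have hroot : ∀ n : ℕ, p.eval (Complex.log u + n * (2 * Real.pi * Complex.I)) = 0 := by
      intro n
      set ℓ := Complex.log u + n * (2 * Real.pi * Complex.I) with hℓ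
      have he : Complex.exp ℓ = u := by
        rw [hℓ, Complex.exp_add, Complex.exp_log hu0, Complex.exp_nat_mul_two_pi_mul_I, mul_one]
      obtain ⟨κ, hκ⟩ := exists_nearEnd b (ℓ := ℓ) (by
        rw [← Complex.norm_exp, he]; simpa using hu)
      have hc : κ.coord = u := by rw [← κ.exp_logCoord, hκ, he]
      have h1 := ha κ
      have h2 := ha' κ
      rw [hκ, hc] at h1 h2
      simp only [hp, Polynomial.eval_sub, Polynomial.eval_finsetSum, Polynomial.eval_mul,
        Polynomial.eval_C, Polynomial.eval_pow, Polynomial.eval_X]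
      rw [← h1, ← h2, sub_self]
    have hp0 : p = 0 := by
      refine Polynomial.eq_zero_of_infinite_isRoot p
        ((Set.infinite_range_of_injective (f := fun n : ℕ =>
          Complex.log u + n * (2 * Real.pi * Complex.I)) ?_).mono ?_)
      · intro n n' hn
        have := mul_right_cancel₀ Complex.two_pi_I_ne_zero (add_left_cancel hn)
        exact_mod_cast this
      · rintro _ ⟨n, rfl⟩
        exact hroot n
    have hcoeff : ∀ (d : ℕ) (g : ℕ → ℂ), (∑ s ∈ Finset.range (d + 1),
        Polynomial.C (g s) * Polynomial.X ^ s).coeff 0 = g 0 := by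
      intro d g
      rw [Finset.sum_range_succ', Polynomial.coeff_add]
      simp
    have := congrArg (fun q => Polynomial.coeff q 0) hp0
    rw [hp] at this
    simp only [Polynomial.coeff_sub, hcoeff, Polynomial.coeff_zero] at this
    exact sub_eq_zero.1 this
  refine tendsto_nhds_unique hm (hm'.congr' ?_)
  filter_upwards [self_mem_nhdsWithin,
    mem_nhdsWithin_of_mem_nhds (Metric.ball_mem_nhds (0 : ℂ) b.radius_pos)] with u hu hu'
  exact (key u hu' hu).symm

end Main

/-! ### Limits at the end point -/

section Associator

variable {X : Type*} [TopologicalSpace X] [ChartedSpace ℂ X] {S : Set X} {P : X}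
  {γ : ℝ → X} {b : BaseDatum S P (reversePath γ)}

/-- The part of degree s of the exponential provides the coefficient of (log u)^s. The part of
degree 0 is 1, leaving H(u) Φ, which is Φ at u = 0. -/
theorem isRegularizedLimit_of_expansion {f : Continuation S γ → ℂ} {g : ι → ℂ → ℂ} {k : ι} {ρ : ℂ}
    {H : ℂ → NCSeries ι} (hH : IsPoleSolution g k ρ b.radius H) (Φ : NCSeries ι) (v : List ι)
    (hf : ∀ κ : NearEnd b,
      f κ.toContinuation = (H κ.coord * expSeries k (ρ * κ.logCoord) * Φ) v) :
    IsRegularizedLimit b f (Φ v) := by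
  have hd : ∀ s, DifferentiableOn ℂ (fun u => (H u * expPart k ρ s * Φ) v)
      (Metric.ball 0 b.radius) := by
    intro s
    simp only [NCSeries.mul_apply]
    exact DifferentiableOn.fun_sum fun n _ => (DifferentiableOn.fun_sum fun m _ =>
      (hH.differentiableOn _).mul_const _).mul_const _
  refine ⟨v.length, fun s u => (H u * expPart k ρ s * Φ) v, hd, fun κ => ?_, ?_⟩
  · rw [hf κ, mul_expSeries_mul_apply]
  · have h : Tendsto (fun u => (H u * expPart k ρ 0 * Φ) v) (𝓝 0)
        (𝓝 ((H 0 * expPart k ρ 0 * Φ) v)) :=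
      ((hd 0).continuousOn.continuousAt (Metric.ball_mem_nhds 0 b.radius_pos)).tendsto
    have h1 : H 0 * expPart k ρ 0 * Φ = Φ := by rw [expPart_zero, hH.zero, one_mul, one_mul]
    rw [h1] at h
    exact h.mono_left nhdsWithin_le_nhds

theorem tendsto_nearEndFilter {g : ι → ℂ → ℂ} {k : ι} {ρ : ℂ}
    {H : ℂ → NCSeries ι} (hH : IsPoleSolution g k ρ b.radius H) (Φ : NCSeries ι) (B : ℝ)
    (v : List ι) :
    Tendsto (fun κ : NearEnd b => (expSeries k (-ρ * κ.logCoord) *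
      (H κ.coord * expSeries k (ρ * κ.logCoord) * Φ)) v) (nearEndFilter b B) (𝓝 (Φ v)) := by
  have h0 : Tendsto (NearEnd.coord (b := b)) (nearEndFilter b B) (𝓝 0) :=
    tendsto_comap.mono_left inf_le_left
  have hB : ∀ᶠ κ in nearEndFilter b B, |(NearEnd.logCoord κ).im| ≤ B :=
    mem_inf_of_right (mem_principal_self _)
  exact (hH.negligible b.radius_pos h0 (Eventually.of_forall fun κ => κ.exp_logCoord)
    hB).tendsto_conj k ρ Φ v

end Associator

end

/-! ### The comparison of the two normalized solutions -/

theorem mainTheorem1 {X : Type*} [TopologicalSpace X] [T2Space X] [CompactSpace X]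
    [ConnectedSpace X] [ChartedSpace ℂ X] [IsManifold 𝓘(ℂ) ω X]
    {ι : Type*} [Finite ι] (S : Set X) (hS : S.Finite)
    (w : ι → OneForm X) (hw : ∀ k, (w k).IsHolomorphicOn Sᶜ)
    (Pi Pj : X) (hPi : Pi ∈ S) (hPj : Pj ∈ S) (ki kj : ι)
    (hi : IsGoodPuncture w Pi ki) (hj : IsGoodPuncture w Pj kj)
    (γ : ℝ → X) (hγ : IsPuncturePath S Pj Pi γ)
    (bj : BaseDatum S Pj γ) (bi : BaseDatum S Pi (reversePath γ)) :
    (∀ κ : Continuation S γ, StartConverges w kj bj κ ∧ EndConverges w ki bi κ) ∧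
    ∃ Φ : NCSeries ι,
      (∀ κ : Continuation S γ, (endSeries w ki bi κ)⁻¹ * startSeries w kj bj κ = Φ) ∧
      (∀ (a : ℕ) (v : List ι), ¬ [ki] <+: v → ∀ B : ℝ,
        Tendsto (fun κ : NearEnd bi => ∑ n ∈ Finset.range (a + 1),
            (-(w ki).residue bi.chart) ^ n * (κ.logCoord ^ n / (n.factorial : ℂ)) *
              startSeries w kj bj κ.toContinuation (List.replicate (a - n) ki ++ v))
          (nearEndFilter bi B) (𝓝 (Φ (List.replicate a ki ++ v)))) ∧
      (∀ v : List ι, IsMZV w kj bj bi v (Φ v) ∧ ∀ m : ℂ, IsMZV w kj bj bi v m → m = Φ v) := by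
  obtain ⟨Hi, hHi⟩ := bi.exists_isPoleSolution hw hi
  obtain ⟨Hj, hHj⟩ := bj.exists_isPoleSolution hw hj
  obtain ⟨Mi, hMi, hMiH⟩ := exists_solution_at_puncture hw hγ.reverse bi hHi
  obtain ⟨Mj, hMj, hMjH⟩ := exists_solution_at_puncture hw hγ bj hHj
  have hrev : ∀ t ∈ Ioo (0 : ℝ) 1, 1 - t ∈ Ioo (0 : ℝ) 1 := fun t ht =>
    ⟨by linarith [ht.2], by linarith [ht.1]⟩
  have hstart := fun κ : Continuation S γ =>
    regSeries_followPath hw hγ bj hHj hMj hMjH κ.time_mem κ.contMDiffOn κ.notMem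
  have hend := fun κ : Continuation S γ =>
    regSeries_followPath hw hγ.reverse bi hHi hMi hMiH (hrev _ κ.time_mem) κ.contMDiffOn κ.notMem
  refine ⟨fun κ => ⟨(hstart κ).1, (hend κ).1⟩, ?_⟩
  have hhalf : (1 / 2 : ℝ) ∈ Ioo (0 : ℝ) 1 := by norm_num
  have hMi' := hMi.reverse hγ
  -- The two solutions are compared at the midpoint; any interior time gives the same series by
  -- `hMΦ`.
  set Φ : NCSeries ι := (Mi (1 - 1 / 2))⁻¹ * Mj (1 / 2) with hΦ
  have hMi0 := hMi.nil _ (hrev _ hhalf)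
  have hΦ0 : Φ [] = 1 := by
    rw [hΦ, NCSeries.mul_nil, NCSeries.inv_nil, hMi0, hMj.nil _ hhalf, inv_one, one_mul]
  have hMΦ : ∀ t ∈ Ioo (0 : ℝ) 1, Mj t = Mi (1 - t) * Φ := fun t ht =>
    hMj.eqOn (hMi'.mul_const Φ hΦ0) ordConnected_Ioo countable_empty hhalf
      (by rw [hΦ, ← mul_assoc, NCSeries.mul_inv_self _ (by rw [hMi0]; exact one_ne_zero), one_mul]) ht
  have hSE : ∀ κ : Continuation S γ, startSeries w kj bj κ = endSeries w ki bi κ * Φ := by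
    intro κ
    rw [startSeries, endSeries, (hstart κ).2, (hend κ).2, hMΦ _ κ.time_mem, mul_assoc]
  have hend0 : ∀ κ : Continuation S γ, endSeries w ki bi κ [] = 1 := by
    intro κ
    rw [endSeries, (hend κ).2, NCSeries.mul_nil, hMi.nil _ (hrev _ κ.time_mem), transport_nil,
      one_mul]
  have hnear : ∀ κ : NearEnd bi, startSeries w kj bj κ.toContinuation =
      Hi κ.coord * NCSeries.expSeries ki ((w ki).residue bi.chart * κ.logCoord) * Φ := by
    intro κ
    rw [hSE, endSeries, (hend κ.toContinuation).2, κ.transport_mul hw hHi hMiH]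
  have hmzv : ∀ v, IsMZV w kj bj bi v (Φ v) := fun v =>
    isRegularizedLimit_of_expansion hHi Φ v fun κ => by rw [hnear κ]
  refine ⟨Φ, fun κ => ?_, fun a v hv B => ?_, fun v => ⟨hmzv v, fun m hm =>
    IsRegularizedLimit.unique hm (hmzv v)⟩⟩
  · rw [hSE, ← mul_assoc, NCSeries.inv_mul_self _ (by rw [hend0]; exact one_ne_zero), one_mul]
  -- The sum is the coefficient of exp(-ρ_i log u · x_i) L_j, in which the divergent exponential has
  -- been removed from the left.
  · refine (tendsto_nearEndFilter hHi Φ B (List.replicate a ki ++ v)).congr fun κ => ?_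
    rw [← hnear κ, NCSeries.expSeries_mul_replicate_append _ _ _ _ hv]
    refine Finset.sum_congr rfl fun n _ => ?_
    rw [mul_pow, mul_div_assoc]
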